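/- For $\tau$ in the upper half plane let $q=e^{2\pi i\tau}$, $\eta(\tau)=q^{1/24}\prod_{n\ge1}(1-q^n)$ and $$\theta_1(\tau|u)=-i\,q^{1/8}z^{1/2}\prod_{n\ge1}(1-q^n)(1-zq^n)(1-z^{-1}q^{n-1}),\qquad z=e^{2\pi i u},$$ with $q^{1/8}=e^{2\pi i\tau/8}$, $z^{1/2}=e^{\pi i u}$. For $\xi=(\xi_1,\dots,\xi_4)\in\mathbb C^4$ put $$\tilde\zeta_1=\tfrac{\xi_1+\xi_2+\xi_3+\xi_4}{2},\quad \tilde\zeta_2=\tfrac{\xi_1-\xi_2-\xi_3+\xi_4}{2},\quad \tilde\zeta_3=\tfrac{-\xi_1+\xi_2-\xi_3+\xi_4}{2},\quad \tilde\zeta_4=\tfrac{-\xi_1-\xi_2+\xi_3+\xi_4}{2},$$ and let $$Z_1(\tau|\xi)=\prod_{A=1}^4\frac{\theta_1(\tau|\tilde\zeta_A)}{\theta_1(\tau|\xi_A)}$$ be the flavored elliptic genus of the $\mathbb R^8$ sigma model. With the Hecke operators $$T_MZ_1(\tau|\xi)=\frac1M\sum_{d|M}\sum_{b=0}^{M/d-1}Z_1\!\left(\left.\tfrac{d\tau+b}{M/d}\right|d\xi\right)\qquad(M\ge1),$$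 the elliptic genera $Z_N$ of the $\mathrm{Sym}^N(\mathbb R^8)$ sigma models are defined by the identity of formal power series in $p$ $$1+\sum_{N\ge1}p^NZ_N=\exp\Big(\sum_{M\ge1}p^M\,T_MZ_1\Big).$$ At a point $\xi$ with $\xi_1+\xi_2+\xi_3+\xi_4=0$ the index is $$\mathcal I_N(\tau|\xi)=-\left.\frac{\partial}{\partial b_1}\right|_{b_1=1}Z_N,\qquad b_1=e^{2\pi i\tilde\zeta_1},$$ the derivative being taken with $\tilde\zeta_2,\tilde\zeta_3,\tilde\zeta_4$ fixed and $\tilde\zeta_1=\frac{1}{2\pi i}\log b_1$ (principal branch); in particular $\mathcal I_1=-\partial_{b_1}|_{b_1=1}Z_1$. Call $(\tau,\xi)$ regular if $\theta_1(\tau|\xi_A)\ne0$ for $A=1,\dots,4$. Let $\operatorname{Im}\tau>0$, $\xi_1+\xi_2+\xi_3+\xi_4=0$ and $N\ge1$. 1. If $(\tau,\xi)$ is regular, then the derivative defining $\mathcal I_1(\tau|\xi)$ exists and $$\mathcal I_1(\tau|\xi)=i\,\eta(\tau)^3\,\frac{\prod_{B=1}^3\theta_1(\tau|\xi_B+\xi_4)}{\prod_{A=1}^4\theta_1(\tau|\xi_A)}.$$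 2. If $\left(\frac{d\tau+b}{N/d},d\xi\right)$ and $(\tau,d\xi)$ are regular for all $d|N$ and $0\le b<N/d$ (that is, no term below has a pole), then $$\frac1N\sum_{d|N}\sum_{b=0}^{N/d-1}d\,\mathcal I_1\!\left(\left.\tfrac{d\tau+b}{N/d}\right|d\xi\right)=\sum_{d|N}\mathcal I_1(\tau|d\xi).$$ 3. If $(\tau,d\xi)$ is regular for all $d|N$, and $\left(\frac{d\tau+b}{M/d},d\xi\right)$ is regular for all $1\le M\le N$, $d|M$ and $0\le b<M/d$, then the derivative defining $\mathcal I_N(\tau|\xi)$ exists and $$\mathcal I_N(\tau|\xi)=\frac1N\sum_{d|N}\sum_{b=0}^{N/d-1}d\,\mathcal I_1\!\left(\left.\tfrac{d\tau+b}{N/d}\right|d\xi\right)=\sum_{d|N}\mathcal I_1(\tau|d\xi).$$ -/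

import Mathlib

namespace SymR8

open Complex

noncomputable section

/-- The Jacobi theta function
`θ₁(τ|u) = -i q^(1/8) z^(1/2) ∏_{n ≥ 1} (1 - q^n) (1 - z q^n) (1 - z⁻¹ q^(n-1))`
with `q = exp (2πiτ)` and `z = exp (2πiu)`; here `q^(1/8) = exp (2πiτ/8)` and
`z^(1/2) = exp (πiu)`, and the product index is shifted to start at `0`. -/
def theta1 (τ u : ℂ) : ℂ :=
  -I * exp (2 * Real.pi * I * τ / 8) * exp (Real.pi * I * u) *
    ∏' n : ℕ, (1 - exp (2 * Real.pi * I * τ) ^ (n + 1)) *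
      (1 - exp (2 * Real.pi * I * u) * exp (2 * Real.pi * I * τ) ^ (n + 1)) *
      (1 - (exp (2 * Real.pi * I * u))⁻¹ * exp (2 * Real.pi * I * τ) ^ n)

/-- The change of basis `ζ̃ = M ξ` from the vector weights to the spinor weights of `Spin(8)`. -/
def spinorMatrix : Matrix (Fin 4) (Fin 4) ℂ :=
  !![1 / 2, 1 / 2, 1 / 2, 1 / 2;
     1 / 2, -1 / 2, -1 / 2, 1 / 2;
     -1 / 2, 1 / 2, -1 / 2, 1 / 2;
     -1 / 2, -1 / 2, 1 / 2, 1 / 2]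

/-- The flavored elliptic genus of the `ℝ⁸` sigma model,
`Z₁(τ|ξ) = ∏_A θ₁(τ|ζ̃_A) / ∏_A θ₁(τ|ξ_A)` with `ζ̃ = M ξ`. -/
def Z1 (τ : ℂ) (ξ : Fin 4 → ℂ) : ℂ :=
  (∏ A, theta1 τ (spinorMatrix.mulVec ξ A)) / ∏ A, theta1 τ (ξ A)

/-- The Hecke operator
`(T_M F)(τ|ξ) = (1/M) ∑_{d ∣ M} ∑_{b=0}^{M/d-1} F((dτ+b)/(M/d) | dξ)` (zero for `M = 0`). -/
def heckeT (M : ℕ) (F : ℂ → (Fin 4 → ℂ) → ℂ) (τ : ℂ) (ξ : Fin 4 → ℂ) : ℂ :=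
  (1 / (M : ℂ)) * ∑ d ∈ M.divisors, ∑ b ∈ Finset.range (M / d),
    F (((d : ℂ) * τ + b) / ((M / d : ℕ) : ℂ)) (fun A => (d : ℂ) * ξ A)

/-- The generating series `∑_{M ≥ 1} p^M (T_M Z₁)(τ|ξ)`; its constant coefficient is `0`. -/
def heckeSeries (τ : ℂ) (ξ : Fin 4 → ℂ) : PowerSeries ℂ :=
  PowerSeries.mk fun M => heckeT M Z1 τ ξ

lemma constantCoeff_heckeSeries (τ : ℂ) (ξ : Fin 4 → ℂ) :
    PowerSeries.constantCoeff (heckeSeries τ ξ) = 0 := by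
  simp [heckeSeries, heckeT]

/-- The flavored elliptic genus `Z_N(τ|ξ)` of the `Sym^N(ℝ⁸)` sigma model, given by
`1 + ∑_{N ≥ 1} p^N Z_N = exp (∑_{M ≥ 1} p^M T_M Z₁)` as formal power series in `p`. -/
def symZ (N : ℕ) (τ : ℂ) (ξ : Fin 4 → ℂ) : ℂ :=
  PowerSeries.coeff N
    ((PowerSeries.exp ℂ).subst (heckeSeries τ ξ) : PowerSeries ℂ)

/-- For `∑ ξ_A = 0`, the point whose first spinor coordinate `ζ̃₁ = (ξ₁+ξ₂+ξ₃+ξ₄)/2` is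
`log b / (2πi)`, that is `b₁ = exp (2πiζ̃₁) = b`, and whose other spinor coordinates
`ζ̃₂, ζ̃₃, ζ̃₄` are those of `ξ` (lemma `mulVec_withB1`). -/
def withB1 (ξ : Fin 4 → ℂ) (b : ℂ) : Fin 4 → ℂ :=
  fun A => ξ A + (1 / 2) * (log b / (2 * Real.pi * I))

lemma mulVec_withB1 (ξ : Fin 4 → ℂ) (hξ : ∑ A, ξ A = 0) (b : ℂ) :
    spinorMatrix.mulVec (withB1 ξ b) =
      Function.update (spinorMatrix.mulVec ξ) 0 (log b / (2 * Real.pi * I)) := by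
  rw [Fin.sum_univ_four] at hξ
  funext A
  fin_cases A
  · simp [spinorMatrix, withB1, Matrix.mulVec, dotProduct, Fin.sum_univ_four]
    linear_combination (1 / 2) * hξ
  all_goals
    simp [spinorMatrix, withB1, Matrix.mulVec, dotProduct, Fin.sum_univ_four]
    ring

/-- The index operation `-∂/∂b₁` at `b₁ = 1`, at a point `ξ` with `∑ ξ_A = 0`. -/
def indexOp (F : (Fin 4 → ℂ) → ℂ) (ξ : Fin 4 → ℂ) : ℂ :=
  -deriv (fun b : ℂ => F (withB1 ξ b)) 1

/-- The index `I₁` of the `ℝ⁸` sigma model. -/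
def I1 (τ : ℂ) (ξ : Fin 4 → ℂ) : ℂ := indexOp (Z1 τ) ξ

/-- The index `I_N` of the `Sym^N(ℝ⁸)` sigma model. -/
def symIndex (N : ℕ) (τ : ℂ) (ξ : Fin 4 → ℂ) : ℂ := indexOp (symZ N τ) ξ

/-- `(τ, ξ)` does not lie on the polar locus of `Z₁` and `I₁`. -/
def Regular (τ : ℂ) (ξ : Fin 4 → ℂ) : Prop := ∀ A, theta1 τ (ξ A) ≠ 0

/-- Every argument at which `T_M F` evaluates `F` is regular. -/
def HeckeRegular (M : ℕ) (τ : ℂ) (ξ : Fin 4 → ℂ) : Prop :=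
  ∀ d ∈ M.divisors, ∀ b ∈ Finset.range (M / d),
    Regular (((d : ℂ) * τ + b) / ((M / d : ℕ) : ℂ)) (fun A => (d : ℂ) * ξ A)

end

end SymR8

open SymR8

namespace SymR8

open Complex Filter Topology

noncomputable section

/-! When the `ξ A` sum to zero, the first spinor coordinate is zero, so the numerator of `Z1`
contains the factor `theta1 τ 0 = 0`. Hence the derivative in `b₁` only sees the simple zero of
`theta1` at the origin, where the slope is `2πη³`; this gives the theta quotient of part 1.

Part 2 rests on turning that product into a sum. The addition formula, with `ρ = θ₁'/θ₁`, `θ₁'(0)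
θ₁(a+b) θ₁(a+c) θ₁(b+c) / (θ₁(a) θ₁(b) θ₁(c) θ₁(a+b+c)) = ρ(a) + ρ(b) + ρ(c) - ρ(a+b+c)`, is proved
by Liouville's theorem (`thetaDefect_eq_zero`). At `a, b, c = ξ 0, ξ 1, ξ 2` it says that `I1` is
the sum over `A` of `thetaLog τ (ξ A)`, where `thetaLog = -ρ/(2πi)`. The Hecke identity can then be
checked for one variable at a time. Expand `thetaLog` as a series of terms `x/(1-x)`, with `x =
z^{±1} q^n`. Summing over `b` averages the `n`-th term over roots of unity of order `a / gcd(n, a)`,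
where `a = N/d`. The averaged terms are those of the right-hand side, permuted by an involution of
pairs (divisor of `N`, natural number); see `hecke_sum_thetaLog`.

For part 3, every `T_M Z₁` vanishes at `b₁ = 1`, so all powers beyond the first in the exponential
have zero derivative there. Therefore `I_N` comes from `T_N Z₁` alone, and the chain rule in `dξ`
supplies the weight `d`. -/

/-! ### Infinite products and their logarithmic derivatives -/

/-- The infinite product `∏_{n ≥ 0} (1 - x q ^ n)`. -/
def qProd (q x : ℂ) : ℂ := ∏' n : ℕ, (1 - x * q ^ n)

lemma summable_norm_mul_pow {q : ℂ} (hq : ‖q‖ < 1) (x : ℂ) :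
    Summable fun n : ℕ => ‖-(x * q ^ n)‖ := by
  simpa using (summable_geometric_of_lt_one (norm_nonneg q) hq).mul_left ‖x‖

lemma multipliable_qProd {q : ℂ} (hq : ‖q‖ < 1) (x : ℂ) :
    Multipliable fun n : ℕ => 1 - x * q ^ n := by
  simpa only [sub_eq_add_neg] using multipliable_one_add_of_summable (summable_norm_mul_pow hq x)

lemma qProd_eq_mul {q : ℂ} (hq : ‖q‖ < 1) (x : ℂ) : qProd q x = (1 - x) * qProd q (x * q) := by
  have h : ∀ n : ℕ, 1 - x * q * q ^ n = 1 - x * q ^ (n + 1) := fun n => by ring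
  have hm : Multipliable fun n : ℕ => 1 - x * q ^ (n + 1) :=
    (multipliable_qProd hq (x * q)).congr h
  have key := tprod_eq_zero_mul' (f := fun n : ℕ => 1 - x * q ^ n) hm
  simp only [pow_zero, mul_one] at key
  simp only [qProd, h]
  exact key

lemma qProd_eq_zero_iff {q : ℂ} (hq : ‖q‖ < 1) (x : ℂ) :
    qProd q x = 0 ↔ ∃ n : ℕ, x * q ^ n = 1 := by
  constructor
  · intro h
    by_contra! hne
    refine tprod_one_add_ne_zero_of_summable (f := fun n : ℕ => -(x * q ^ n)) (fun n => ?_)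
      (summable_norm_mul_pow hq x) (by simpa only [← sub_eq_add_neg, qProd] using h)
    rw [← sub_eq_add_neg]
    exact sub_ne_zero.2 (hne n).symm
  · rintro ⟨n, hn⟩
    induction n generalizing x with
    | zero => rw [qProd_eq_mul hq, show x = 1 by simpa using hn]; simp
    | succ n ih => rw [qProd_eq_mul hq, ih (x * q) (by rw [← hn]; ring), mul_zero]

lemma multipliableLocallyUniformlyOn_qProd {q : ℂ} (hq : ‖q‖ < 1) (R : ℝ) :
    MultipliableLocallyUniformlyOn (fun (n : ℕ) x => 1 - x * q ^ n) (Metric.ball (0 : ℂ) R) := by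
  have h := Summable.multipliableLocallyUniformlyOn_nat_one_add
    (f := fun (n : ℕ) (x : ℂ) => -(x * q ^ n)) (K := Metric.ball (0 : ℂ) R) Metric.isOpen_ball
    ((summable_geometric_of_lt_one (norm_nonneg q) hq).mul_left R)
    (Eventually.of_forall fun n x hx => ?_) (fun n => by fun_prop)
  · simpa only [← sub_eq_add_neg] using h
  · rw [norm_neg, norm_mul, norm_pow]
    have : ‖x‖ ≤ R := by simpa using (Metric.mem_ball.1 hx).le
    gcongr

lemma differentiable_qProd {q : ℂ} (hq : ‖q‖ < 1) : Differentiable ℂ (qProd q) := by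
  intro x
  have hx : x ∈ Metric.ball (0 : ℂ) (‖x‖ + 1) := by simp
  refine ((multipliableLocallyUniformlyOn_qProd hq
    (‖x‖ + 1)).hasProdLocallyUniformlyOn.differentiableOn
    (Eventually.of_forall fun s => ?_) Metric.isOpen_ball).differentiableAt
      (Metric.isOpen_ball.mem_nhds hx)
  simpa [Finset.prod_fn] using DifferentiableOn.finsetProd (fun _ _ => by fun_prop)

/-- The value `x / (1 - x)` of the geometric series without its constant term. -/
def geomTail (x : ℂ) : ℂ := x / (1 - x)

lemma summable_geomTail {q : ℂ} (hq : ‖q‖ < 1) (x : ℂ) :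
    Summable fun n : ℕ => geomTail (x * q ^ n) := by
  have h0 : Tendsto (fun n : ℕ => x * q ^ n) atTop (𝓝 0) := by
    simpa using (tendsto_pow_atTop_nhds_zero_of_norm_lt_one hq).const_mul x
  have h1 : Tendsto (fun n : ℕ => (1 - x * q ^ n)⁻¹) atTop (𝓝 1) := by
    simpa using (tendsto_const_nhds (x := (1 : ℂ)).sub h0).inv₀ (by simp)
  refine summable_of_isBigO_nat (g := fun n : ℕ => ‖-(x * q ^ n)‖) (summable_norm_mul_pow hq x) ?_
  have h2 : (fun n : ℕ => geomTail (x * q ^ n)) = fun n => x * q ^ n * (1 - x * q ^ n)⁻¹ := by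
    funext n; rw [geomTail, div_eq_mul_inv]
  rw [h2]
  simpa using (Asymptotics.isBigO_refl (fun n : ℕ => x * q ^ n) atTop).mul
    (h1.isBigO_one ℂ) |>.norm_right

lemma mul_logDeriv_qProd {q : ℂ} (hq : ‖q‖ < 1) {x : ℂ} (hx : qProd q x ≠ 0) :
    x * logDeriv (qProd q) x = -∑' n : ℕ, geomTail (x * q ^ n) := by
  have hne : ∀ n : ℕ, 1 - x * q ^ n ≠ 0 := fun n h =>
    hx ((qProd_eq_zero_iff hq x).2 ⟨n, (sub_eq_zero.1 h).symm⟩)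
  have hterm : ∀ n : ℕ, logDeriv (fun y : ℂ => 1 - y * q ^ n) x = -q ^ n / (1 - x * q ^ n) := by
    intro n
    simp [logDeriv_apply]
  -- The termwise rewriting below divides by `x`; at `x = 0` both sides vanish.
  by_cases hx0 : x = 0
  · simp [hx0, geomTail]
  have hterm' : ∀ n : ℕ, logDeriv (fun y : ℂ => 1 - y * q ^ n) x
      = -x⁻¹ * geomTail (x * q ^ n) := by
    intro n
    have := hne n
    rw [hterm, geomTail]
    field_simp
  have h := logDeriv_tprod_eq_tsum (f := fun (n : ℕ) y => 1 - y * q ^ n)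
    (s := Metric.ball (0 : ℂ) (‖x‖ + 1)) (x := x) Metric.isOpen_ball (by simp) hne
    (fun n => by fun_prop) (by simpa only [hterm'] using (summable_geomTail hq x).mul_left _)
    (multipliableLocallyUniformlyOn_qProd hq _) hx
  simp only [hterm', tsum_mul_left] at h
  change x * logDeriv (fun y => ∏' n : ℕ, (1 - y * q ^ n)) x = _
  rw [h]
  field_simp

/-! ### The theta function: product form, quasi-periodicity, zeros -/

/-- The exponential `exp (2πiu)`. -/
def expTwoPiI (u : ℂ) : ℂ := exp (2 * Real.pi * I * u)

lemma expTwoPiI_ne_zero (u : ℂ) : expTwoPiI u ≠ 0 := exp_ne_zero _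

lemma expTwoPiI_add (u v : ℂ) : expTwoPiI (u + v) = expTwoPiI u * expTwoPiI v := by
  rw [expTwoPiI, mul_add, exp_add]; rfl

lemma expTwoPiI_neg (u : ℂ) : expTwoPiI (-u) = (expTwoPiI u)⁻¹ := by
  rw [expTwoPiI, mul_neg, exp_neg]; rfl

lemma expTwoPiI_natCast_mul (n : ℕ) (u : ℂ) : expTwoPiI (n * u) = expTwoPiI u ^ n := by
  rw [expTwoPiI, expTwoPiI, ← exp_nat_mul]; ring_nf

lemma expTwoPiI_zero : expTwoPiI 0 = 1 := by simp [expTwoPiI]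

lemma expTwoPiI_one : expTwoPiI 1 = 1 := by simp [expTwoPiI]

lemma expTwoPiI_eq_one_iff (u : ℂ) : expTwoPiI u = 1 ↔ ∃ m : ℤ, u = m := by
  rw [expTwoPiI, exp_eq_one_iff]
  have h := two_pi_I_ne_zero
  refine exists_congr fun m => ⟨fun H => mul_left_cancel₀ h (H.trans (mul_comm _ _)), fun H => ?_⟩
  rw [H, mul_comm]

lemma hasDerivAt_expTwoPiI (u : ℂ) :
    HasDerivAt expTwoPiI (2 * Real.pi * I * expTwoPiI u) u := by
  have h := ((hasDerivAt_id u).const_mul (2 * Real.pi * I)).cexp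
  change HasDerivAt (fun u => exp (2 * Real.pi * I * u)) _ u
  convert! h using 1
  simp only [expTwoPiI, id_eq, mul_one]
  ring

lemma norm_expTwoPiI_lt_one {τ : ℂ} (hτ : 0 < τ.im) : ‖expTwoPiI τ‖ < 1 :=
  UpperHalfPlane.norm_exp_two_pi_I_lt_one ⟨τ, hτ⟩

lemma theta1_eq_qProd {τ : ℂ} (hτ : 0 < τ.im) (u : ℂ) :
    theta1 τ u = -I * exp (2 * Real.pi * I * τ / 8) * exp (Real.pi * I * u) *
      (qProd (expTwoPiI τ) (expTwoPiI τ) * qProd (expTwoPiI τ) (expTwoPiI u * expTwoPiI τ) *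
        qProd (expTwoPiI τ) (expTwoPiI u)⁻¹) := by
  have hq := norm_expTwoPiI_lt_one hτ
  have h1 := multipliable_qProd hq (expTwoPiI τ)
  have h2 := multipliable_qProd hq (expTwoPiI u * expTwoPiI τ)
  have h3 := multipliable_qProd hq (expTwoPiI u)⁻¹
  rw [qProd, qProd, qProd, ← h1.tprod_mul h2, ← (h1.mul h2).tprod_mul h3, theta1]
  simp only [pow_succ', mul_assoc, expTwoPiI]

/-- Isolates the one factor that vanishes at `u = 0`. The remaining products are exchanged by `u ↦
-u`, which makes oddness visible. -/
lemma theta1_eq_one_sub_mul {τ : ℂ} (hτ : 0 < τ.im) (u : ℂ) :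
    theta1 τ u = exp (Real.pi * I * u) * (1 - (expTwoPiI u)⁻¹) *
      (-I * exp (2 * Real.pi * I * τ / 8) *
      (qProd (expTwoPiI τ) (expTwoPiI τ) * qProd (expTwoPiI τ) (expTwoPiI u * expTwoPiI τ) *
        qProd (expTwoPiI τ) ((expTwoPiI u)⁻¹ * expTwoPiI τ))) := by
  rw [theta1_eq_qProd hτ, qProd_eq_mul (norm_expTwoPiI_lt_one hτ) (expTwoPiI u)⁻¹]
  ring

lemma differentiable_expTwoPiI : Differentiable ℂ expTwoPiI :=
  fun u => (hasDerivAt_expTwoPiI u).differentiableAt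

lemma differentiable_theta1 {τ : ℂ} (hτ : 0 < τ.im) : Differentiable ℂ (theta1 τ) := by
  have hP := differentiable_qProd (norm_expTwoPiI_lt_one hτ)
  have he := differentiable_expTwoPiI
  rw [funext (theta1_eq_qProd hτ)]
  have h1 : Differentiable ℂ fun u => qProd (expTwoPiI τ) (expTwoPiI u * expTwoPiI τ) :=
    hP.comp (he.mul_const _)
  have h2 : Differentiable ℂ fun u => qProd (expTwoPiI τ) (expTwoPiI u)⁻¹ :=
    hP.comp (he.inv expTwoPiI_ne_zero)
  fun_prop

lemma differentiable_deriv_theta1 {τ : ℂ} (hτ : 0 < τ.im) :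
    Differentiable ℂ (deriv (theta1 τ)) :=
  (differentiable_theta1 hτ).deriv

lemma theta1_zero (τ : ℂ) (hτ : 0 < τ.im) : theta1 τ 0 = 0 := by
  simp [theta1_eq_one_sub_mul hτ, expTwoPiI_zero]

lemma theta1_neg {τ : ℂ} (hτ : 0 < τ.im) (u : ℂ) : theta1 τ (-u) = -theta1 τ u := by
  rw [theta1_eq_one_sub_mul hτ, theta1_eq_one_sub_mul hτ, expTwoPiI_neg, inv_inv]
  have h : expTwoPiI u = exp (Real.pi * I * u) * exp (Real.pi * I * u) := by
    rw [expTwoPiI, ← exp_add]; ring_nf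
  have h0 := exp_ne_zero (Real.pi * I * u)
  have h1 : exp (Real.pi * I * -u) * (1 - expTwoPiI u)
      = -(exp (Real.pi * I * u) * (1 - (expTwoPiI u)⁻¹)) := by
    rw [mul_neg, exp_neg, h]
    field_simp
    ring
  rw [h1]
  ring

lemma theta1_add_one {τ : ℂ} (hτ : 0 < τ.im) (u : ℂ) : theta1 τ (u + 1) = -theta1 τ u := by
  rw [theta1_eq_qProd hτ, theta1_eq_qProd hτ, expTwoPiI_add, expTwoPiI_one, mul_one]
  have : exp (Real.pi * I * (u + 1)) = -exp (Real.pi * I * u) := by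
    rw [mul_add, exp_add, mul_one, exp_pi_mul_I]; ring
  rw [this]
  ring

/-- The automorphy factor of `theta1 τ` under translation by `τ`. -/
def thetaFactor (τ u : ℂ) : ℂ := -exp (-(Real.pi * I * τ)) * exp (-(2 * Real.pi * I * u))

lemma thetaFactor_ne_zero (τ u : ℂ) : thetaFactor τ u ≠ 0 :=
  mul_ne_zero (neg_ne_zero.2 (exp_ne_zero _)) (exp_ne_zero _)

lemma theta1_add_self {τ : ℂ} (hτ : 0 < τ.im) (u : ℂ) :
    theta1 τ (u + τ) = thetaFactor τ u * theta1 τ u := by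
  have hq := norm_expTwoPiI_lt_one hτ
  rw [theta1_eq_qProd hτ, theta1_eq_qProd hτ, expTwoPiI_add, qProd_eq_mul hq (expTwoPiI u * _),
    qProd_eq_mul hq (expTwoPiI u * expTwoPiI τ)⁻¹]
  have hz := expTwoPiI_ne_zero u
  have hw := expTwoPiI_ne_zero τ
  have h1 : (expTwoPiI u * expTwoPiI τ)⁻¹ * expTwoPiI τ = (expTwoPiI u)⁻¹ := by
    field_simp
  have h2 : exp (Real.pi * I * (u + τ)) * (1 - (expTwoPiI u * expTwoPiI τ)⁻¹)
      = thetaFactor τ u * exp (Real.pi * I * u) * (1 - expTwoPiI u * expTwoPiI τ) := by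
    have e1 : exp (Real.pi * I * (u + τ)) =
        exp (-(Real.pi * I * τ)) * exp (Real.pi * I * u) * expTwoPiI τ := by
      rw [expTwoPiI, ← exp_add, ← exp_add]; ring_nf
    have e2 : exp (-(2 * Real.pi * I * u)) = (expTwoPiI u)⁻¹ := by
      rw [exp_neg]; rfl
    rw [e1, thetaFactor, e2]
    field_simp
    ring
  rw [h1]
  linear_combination (-I * exp (2 * Real.pi * I * τ / 8) * qProd (expTwoPiI τ) (expTwoPiI τ) *
    qProd (expTwoPiI τ) (expTwoPiI u * expTwoPiI τ * expTwoPiI τ) *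
    qProd (expTwoPiI τ) (expTwoPiI u)⁻¹) * h2

lemma deriv_theta1_neg {τ : ℂ} (hτ : 0 < τ.im) (u : ℂ) :
    deriv (theta1 τ) (-u) = deriv (theta1 τ) u := by
  have h : (fun v => theta1 τ (-v)) = fun v => -theta1 τ v := funext (theta1_neg hτ)
  have := congrArg (fun f => deriv f u) h
  simpa [deriv_comp_neg] using this

lemma deriv_theta1_add_one {τ : ℂ} (hτ : 0 < τ.im) (u : ℂ) :
    deriv (theta1 τ) (u + 1) = -deriv (theta1 τ) u := by
  have h : (fun v => theta1 τ (v + 1)) = fun v => -theta1 τ v := funext (theta1_add_one hτ)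
  have := congrArg (fun f => deriv f u) h
  simpa [deriv_comp_add_const] using this

lemma hasDerivAt_thetaFactor (τ u : ℂ) :
    HasDerivAt (thetaFactor τ) (-(2 * Real.pi * I) * thetaFactor τ u) u := by
  have h := (((hasDerivAt_id u).const_mul (2 * Real.pi * I)).neg.cexp).const_mul
    (-exp (-(Real.pi * I * τ)))
  convert! h using 1
  simp [thetaFactor]
  ring

lemma deriv_theta1_add_self {τ : ℂ} (hτ : 0 < τ.im) (u : ℂ) :
    deriv (theta1 τ) (u + τ) =
      thetaFactor τ u * (deriv (theta1 τ) u - 2 * Real.pi * I * theta1 τ u) := by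
  have h : (fun v => theta1 τ (v + τ)) = fun v => thetaFactor τ v * theta1 τ v :=
    funext (theta1_add_self hτ)
  have h1 := congrArg (fun f => deriv f u) h
  have h2 := ((hasDerivAt_thetaFactor τ u).mul (differentiable_theta1 hτ u).hasDerivAt).deriv
  simp only [deriv_comp_add_const] at h1
  rw [h1]
  refine Eq.trans h2 ?_
  ring

/-- A property invariant under translation by `1` and by `τ` is invariant under `ℤ + ℤτ`. -/
lemma lattice_translate_iff {τ : ℂ} {p : ℂ → Prop} (h1 : ∀ u, p (u + 1) ↔ p u)
    (hτ : ∀ u, p (u + τ) ↔ p u) (m n : ℤ) (u : ℂ) : p (u + m + n * τ) ↔ p u := by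
  have key : ∀ (w : ℂ), (∀ u, p (u + w) ↔ p u) → ∀ (k : ℤ) (u : ℂ), p (u + k * w) ↔ p u := by
    intro w hw k u
    induction k using Int.induction_on with
    | zero => simp
    | succ k ih =>
      rw [← ih, ← hw (u + ((k : ℤ) : ℂ) * w)]
      push_cast
      ring_nf
    | pred k ih =>
      rw [← ih, ← hw (u + ((-(k : ℤ) - 1 : ℤ) : ℂ) * w)]
      push_cast
      ring_nf
  rw [key τ hτ]
  simpa using key 1 h1 m u

lemma theta1_eq_zero_iff {τ : ℂ} (hτ : 0 < τ.im) (u : ℂ) :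
    theta1 τ u = 0 ↔ ∃ m n : ℤ, u = m + n * τ := by
  have hq := norm_expTwoPiI_lt_one hτ
  constructor
  · intro h
    rw [theta1_eq_qProd hτ] at h
    have hqq : qProd (expTwoPiI τ) (expTwoPiI τ) ≠ 0 := by
      rw [Ne, qProd_eq_zero_iff hq]
      rintro ⟨n, hn⟩
      have h1 : ‖expTwoPiI τ ^ (n + 1)‖ < 1 := by
        rw [norm_pow]; exact pow_lt_one₀ (norm_nonneg _) hq (by simp)
      rw [pow_succ', hn] at h1
      simp at h1
    have h' : qProd (expTwoPiI τ) (expTwoPiI u * expTwoPiI τ) = 0 ∨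
        qProd (expTwoPiI τ) (expTwoPiI u)⁻¹ = 0 := by
      simpa [exp_ne_zero, hqq] using h
    rcases h' with h' | h'
    · obtain ⟨n, hn⟩ := (qProd_eq_zero_iff hq _).1 h'
      rw [← expTwoPiI_natCast_mul, ← expTwoPiI_add, ← expTwoPiI_add, expTwoPiI_eq_one_iff] at hn
      obtain ⟨m, hm⟩ := hn
      refine ⟨m, -(n + 1), ?_⟩
      push_cast
      linear_combination hm
    · obtain ⟨n, hn⟩ := (qProd_eq_zero_iff hq _).1 h'
      rw [← expTwoPiI_natCast_mul, ← expTwoPiI_neg, ← expTwoPiI_add, expTwoPiI_eq_one_iff] at hn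
      obtain ⟨m, hm⟩ := hn
      refine ⟨-m, n, ?_⟩
      push_cast
      linear_combination -hm
  · rintro ⟨m, n, rfl⟩
    have h := lattice_translate_iff (τ := τ) (p := fun u => theta1 τ u = 0)
      (fun u => by rw [theta1_add_one hτ, neg_eq_zero])
      (fun u => by rw [theta1_add_self hτ, mul_eq_zero, or_iff_right (thetaFactor_ne_zero τ u)])
      m n 0
    rw [zero_add] at h
    exact h.2 (theta1_zero τ hτ)

lemma eta_eq_qProd (τ : ℂ) :
    ModularForm.eta τ = exp (2 * Real.pi * I * τ / 24) * qProd (expTwoPiI τ) (expTwoPiI τ) := by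
  rw [ModularForm.eta, qProd]
  congr 1
  refine tprod_congr fun n => ?_
  rw [ModularForm.eta_q_eq_pow, pow_succ']
  rfl

/-- Only the factor `1 - z⁻¹` is differentiated. At `u = 0` the three remaining products coincide,
and `q^(1/8) = (q^(1/24))³`, so they assemble to `η³`; the constant is `-i · 2πi = 2π`. -/
lemma hasDerivAt_theta1_zero {τ : ℂ} (hτ : 0 < τ.im) :
    HasDerivAt (theta1 τ) (2 * Real.pi * ModularForm.eta τ ^ 3) 0 := by
  have hP := differentiable_qProd (norm_expTwoPiI_lt_one hτ)
  have he := differentiable_expTwoPiI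
  have h1 : Differentiable ℂ fun u => qProd (expTwoPiI τ) (expTwoPiI u * expTwoPiI τ) :=
    hP.comp (he.mul_const _)
  have h2 : Differentiable ℂ fun u => qProd (expTwoPiI τ) ((expTwoPiI u)⁻¹ * expTwoPiI τ) :=
    hP.comp ((he.inv expTwoPiI_ne_zero).mul_const _)
  have hA : Differentiable ℂ fun u => (-I * exp (2 * Real.pi * I * τ / 8) *
      (qProd (expTwoPiI τ) (expTwoPiI τ) * qProd (expTwoPiI τ) (expTwoPiI u * expTwoPiI τ) *
        qProd (expTwoPiI τ) ((expTwoPiI u)⁻¹ * expTwoPiI τ))) := by fun_prop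
  have hE : HasDerivAt (fun u : ℂ => exp (Real.pi * I * u)) (Real.pi * I) 0 := by
    simpa using ((hasDerivAt_id (0 : ℂ)).const_mul (Real.pi * I)).cexp
  have hF : HasDerivAt (fun u : ℂ => 1 - (expTwoPiI u)⁻¹) (2 * Real.pi * I) 0 := by
    simpa [expTwoPiI_zero] using
      ((hasDerivAt_expTwoPiI 0).inv (expTwoPiI_ne_zero 0)).const_sub 1
  have h := (hE.mul hF).mul (hA 0).hasDerivAt
  rw [funext (theta1_eq_one_sub_mul hτ)]
  convert! h using 1
  have h8 : exp (2 * Real.pi * I * τ / 8) = exp (2 * Real.pi * I * τ / 24) ^ 3 := by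
    rw [← exp_nat_mul]; push_cast; ring_nf
  simp only [Pi.mul_apply, expTwoPiI_zero, eta_eq_qProd, h8]
  simp only [mul_zero, exp_zero, inv_one, one_mul, sub_self, zero_add, zero_mul, add_zero]
  linear_combination (2 * Real.pi * exp (2 * Real.pi * I * τ / 24) ^ 3 *
    qProd (expTwoPiI τ) (expTwoPiI τ) ^ 3) * I_sq

lemma eta_ne_zero_of_im_pos {τ : ℂ} (hτ : 0 < τ.im) : ModularForm.eta τ ≠ 0 :=
  ModularForm.eta_ne_zero hτ

lemma deriv_theta1_zero_ne_zero {τ : ℂ} (hτ : 0 < τ.im) : deriv (theta1 τ) 0 ≠ 0 := by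
  rw [(hasDerivAt_theta1_zero hτ).deriv]
  have := eta_ne_zero_of_im_pos hτ
  simp [Real.pi_ne_zero, this]

/-! ### The logarithmic derivative as a q-series -/

/-- The `q`-series of the logarithmic derivative of `theta1 τ`, up to the factor `-2πi`. -/
def thetaLog (τ u : ℂ) : ℂ :=
  -(1 / 2) + (∑' n : ℕ, geomTail (expTwoPiI u * expTwoPiI τ * expTwoPiI τ ^ n)) -
    ∑' n : ℕ, geomTail ((expTwoPiI u)⁻¹ * expTwoPiI τ ^ n)

lemma deriv_theta1_eq {τ : ℂ} (hτ : 0 < τ.im) {u : ℂ} (hu : theta1 τ u ≠ 0) :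
    deriv (theta1 τ) u = -(2 * Real.pi * I) * thetaLog τ u * theta1 τ u := by
  have hq := norm_expTwoPiI_lt_one hτ
  have hu' := hu
  rw [theta1_eq_qProd hτ] at hu'
  obtain ⟨⟨-, hn1⟩, hn2⟩ :
      ((qProd (expTwoPiI τ) (expTwoPiI τ) ≠ 0 ∧
      qProd (expTwoPiI τ) (expTwoPiI u * expTwoPiI τ) ≠ 0) ∧
      qProd (expTwoPiI τ) (expTwoPiI u)⁻¹ ≠ 0) := by
    simpa [mul_ne_zero_iff] using right_ne_zero_of_mul hu'
  have hd1 : HasDerivAt (fun v => qProd (expTwoPiI τ) (expTwoPiI v * expTwoPiI τ))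
      (-(2 * Real.pi * I) * (∑' n : ℕ, geomTail (expTwoPiI u * expTwoPiI τ * expTwoPiI τ ^ n)) *
        qProd (expTwoPiI τ) (expTwoPiI u * expTwoPiI τ)) u := by
    have hg := (hasDerivAt_expTwoPiI u).mul_const (expTwoPiI τ)
    have h := (differentiable_qProd hq (expTwoPiI u * expTwoPiI τ)).hasDerivAt.comp u hg
    have hl := mul_logDeriv_qProd hq hn1
    rw [logDeriv_apply, ← mul_div_assoc, div_eq_iff hn1] at hl
    convert! h using 1
    linear_combination -(2 * Real.pi * I) * hl
  have hd2 : HasDerivAt (fun v => qProd (expTwoPiI τ) (expTwoPiI v)⁻¹)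
      ((2 * Real.pi * I) * (∑' n : ℕ, geomTail ((expTwoPiI u)⁻¹ * expTwoPiI τ ^ n)) *
        qProd (expTwoPiI τ) (expTwoPiI u)⁻¹) u := by
    have hg := (hasDerivAt_expTwoPiI u).inv (expTwoPiI_ne_zero u)
    have h := (differentiable_qProd hq (expTwoPiI u)⁻¹).hasDerivAt.comp u hg
    have hl := mul_logDeriv_qProd hq hn2
    rw [logDeriv_apply, ← mul_div_assoc, div_eq_iff hn2] at hl
    convert! h using 1
    have hz := expTwoPiI_ne_zero u
    have : -(2 * Real.pi * I * expTwoPiI u) / expTwoPiI u ^ 2 =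
        -(2 * Real.pi * I) * (expTwoPiI u)⁻¹ := by field_simp
    rw [this]
    linear_combination (2 * Real.pi * I) * hl
  -- The half-power `z^(1/2)` contributes `πi`, which is the constant `-1/2` of `thetaLog`.
  have hE : HasDerivAt (fun v : ℂ => -I * exp (2 * Real.pi * I * τ / 8) * exp (Real.pi * I * v))
      (Real.pi * I * (-I * exp (2 * Real.pi * I * τ / 8) * exp (Real.pi * I * u))) u := by
    have := ((hasDerivAt_id u).const_mul (Real.pi * I)).cexp.const_mul
      (-I * exp (2 * Real.pi * I * τ / 8))
    convert! this using 1
    simp only [id_eq, mul_one]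
    ring
  have h := hE.mul ((hd1.const_mul (qProd (expTwoPiI τ) (expTwoPiI τ))).mul hd2)
  rw [theta1_eq_qProd hτ u, thetaLog]
  rw [show theta1 τ = _ from funext (theta1_eq_qProd hτ)]
  refine (HasDerivAt.deriv (by convert! h using 1)).trans ?_
  simp only [Pi.mul_apply]
  ring

/-! ### The addition formula by Liouville's theorem -/

/-- An entire function vanishing on the zeros of an entire function with only simple zeros is
divisible by it. -/
lemma exists_differentiable_eq_mul {F P : ℂ → ℂ} (hF : Differentiable ℂ F)
    (hP : Differentiable ℂ P) (h : ∀ u, P u = 0 → F u = 0 ∧ deriv P u ≠ 0) :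
    ∃ G : ℂ → ℂ, Differentiable ℂ G ∧ ∀ u, F u = P u * G u := by
  classical
  -- The quotient is filled in by the ratio of derivatives at the zeros of `P`. Near such a zero it
  -- agrees with the quotient of the two `dslope`s.
  refine ⟨fun u => if P u = 0 then deriv F u / deriv P u else F u / P u, fun u => ?_, fun u => ?_⟩
  · by_cases hu : P u = 0
    · obtain ⟨hFu, hPu⟩ := h u hu
      have hdF : DifferentiableAt ℂ (dslope F u) u :=
        (((differentiableOn_dslope univ_mem).2 hF.differentiableOn) u trivial).differentiableAt
          univ_mem
      have hdP : DifferentiableAt ℂ (dslope P u) u :=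
        (((differentiableOn_dslope univ_mem).2 hP.differentiableOn) u trivial).differentiableAt
          univ_mem
      have hne : dslope P u u ≠ 0 := by rwa [dslope_same]
      refine (hdF.div hdP hne).congr_of_eventuallyEq ?_
      filter_upwards [hdP.continuousAt.eventually_ne hne] with v hv
      by_cases hvu : v = u
      · subst hvu
        simp [hu, dslope_same]
      · have hFv : F v = (v - u) * dslope F u v := by
          have := sub_smul_dslope F u v
          rw [hFu, sub_zero] at this
          exact this.symm
        have hPv : P v = (v - u) * dslope P u v := by
          have := sub_smul_dslope P u v
          rw [hu, sub_zero] at this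
          exact this.symm
        have hvu' : v - u ≠ 0 := sub_ne_zero.2 hvu
        rw [if_neg (by rw [hPv]; exact mul_ne_zero hvu' hv), hFv, hPv,
          mul_div_mul_left _ _ hvu']
        rfl
    · refine ((hF u).div (hP u) hu).congr_of_eventuallyEq ?_
      filter_upwards [(hP u).continuousAt.eventually_ne hu] with v hv
      rw [if_neg hv]
      rfl
  · by_cases hu : P u = 0
    · rw [hu, zero_mul, (h u hu).1]
    · simp only [if_neg hu]
      field_simp

/-- An entire elliptic function is constant. -/
lemma eq_of_differentiable_of_periodic {τ : ℂ} (hτ : 0 < τ.im) {G : ℂ → ℂ}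
    (hG : Differentiable ℂ G) (h1 : ∀ u, G (u + 1) = G u) (h2 : ∀ u, G (u + τ) = G u) (u v : ℂ) :
    G u = G v := by
  -- Liouville: by periodicity every value is taken on the compact parallelogram spanned by `1` and
  -- `τ`.
  refine hG.apply_eq_apply_of_bounded ?_ u v
  have hK : IsCompact ((fun p : ℝ × ℝ => (p.1 : ℂ) + p.2 * τ) ''
      (Set.Icc (0 : ℝ) 1 ×ˢ Set.Icc (0 : ℝ) 1)) :=
    (isCompact_Icc.prod isCompact_Icc).image (by fun_prop)
  refine (hK.image hG.continuous).isBounded.subset ?_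
  rintro _ ⟨w, rfl⟩
  set y : ℝ := w.im / τ.im with hy
  set x : ℝ := w.re - y * τ.re with hx
  have hw : w = x + y * τ := by
    apply Complex.ext
    · simp [hx]
    · simp [hy, hτ.ne']
  refine ⟨(Int.fract x : ℝ) + (Int.fract y : ℝ) * τ, ⟨(Int.fract x, Int.fract y),
    ⟨⟨Int.fract_nonneg x, (Int.fract_lt_one x).le⟩,
      ⟨Int.fract_nonneg y, (Int.fract_lt_one y).le⟩⟩, rfl⟩, ?_⟩
  have h := (lattice_translate_iff (τ := τ) (p := fun u => G u = G w)
    (fun u => by rw [h1]) (fun u => by rw [h2]) ⌊x⌋ ⌊y⌋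
    ((Int.fract x : ℝ) + (Int.fract y : ℝ) * τ)).1
  apply h
  congr 1
  rw [hw]
  have e1 : (x : ℂ) = ⌊x⌋ + (Int.fract x : ℝ) := by
    exact_mod_cast (Int.floor_add_fract x).symm
  have e2 : (y : ℂ) = ⌊y⌋ + (Int.fract y : ℝ) := by
    exact_mod_cast (Int.floor_add_fract y).symm
  linear_combination -e1 - τ * e2

lemma deriv_theta1_ne_zero {τ : ℂ} (hτ : 0 < τ.im) {u : ℂ} (hu : theta1 τ u = 0) :
    deriv (theta1 τ) u ≠ 0 := by
  obtain ⟨m, n, rfl⟩ := (theta1_eq_zero_iff hτ u).1 hu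
  have h := (lattice_translate_iff (τ := τ)
    (p := fun u => theta1 τ u = 0 ∧ deriv (theta1 τ) u ≠ 0)
    (fun u => by rw [theta1_add_one hτ, deriv_theta1_add_one hτ, neg_eq_zero, neg_ne_zero])
    (fun u => by
      rw [theta1_add_self hτ, deriv_theta1_add_self hτ, mul_eq_zero,
        or_iff_right (thetaFactor_ne_zero τ u)]
      refine and_congr_right fun h0 => ?_
      rw [h0, mul_zero, sub_zero, mul_ne_zero_iff, and_iff_right (thetaFactor_ne_zero τ u)])
    m n 0).2 ⟨theta1_zero τ hτ, deriv_theta1_zero_ne_zero hτ⟩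
  rw [zero_add] at h
  exact h.2

lemma theta1_sub_eq_zero {τ : ℂ} (hτ : 0 < τ.im) {u v : ℂ} (hu : theta1 τ u = 0)
    (hv : theta1 τ v = 0) : theta1 τ (u - v) = 0 := by
  obtain ⟨m, n, rfl⟩ := (theta1_eq_zero_iff hτ u).1 hu
  obtain ⟨m', n', rfl⟩ := (theta1_eq_zero_iff hτ v).1 hv
  refine (theta1_eq_zero_iff hτ _).2 ⟨m - m', n - n', ?_⟩
  push_cast
  ring

/-- The defect of the addition formula for `theta1 τ`. -/
def thetaDefect (τ a b c : ℂ) : ℂ :=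
  deriv (theta1 τ) 0 * theta1 τ (a + b) * theta1 τ (a + c) * theta1 τ (b + c) -
    theta1 τ b * theta1 τ c *
      (deriv (theta1 τ) a * theta1 τ (a + (b + c)) - theta1 τ a * deriv (theta1 τ) (a + (b + c))) -
    theta1 τ a * theta1 τ (a + (b + c)) *
      (deriv (theta1 τ) b * theta1 τ c + theta1 τ b * deriv (theta1 τ) c)

lemma thetaDefect_add_one {τ : ℂ} (hτ : 0 < τ.im) (a b c : ℂ) :
    thetaDefect τ (a + 1) b c = thetaDefect τ a b c := by
  simp only [thetaDefect, add_right_comm a 1, theta1_add_one hτ, deriv_theta1_add_one hτ]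
  ring

/-- A product of two factors depends only on the sum of the arguments, and both sides have sum `2a +
b + c`. Thus all terms of the defect transform alike. -/
lemma thetaFactor_mul_thetaFactor (τ a b c : ℂ) :
    thetaFactor τ (a + b) * thetaFactor τ (a + c) =
      thetaFactor τ a * thetaFactor τ (a + (b + c)) := by
  have : exp (-(2 * Real.pi * I * (a + b))) * exp (-(2 * Real.pi * I * (a + c))) =
      exp (-(2 * Real.pi * I * a)) * exp (-(2 * Real.pi * I * (a + (b + c)))) := by
    rw [← exp_add, ← exp_add]; ring_nf
  simp only [thetaFactor]
  linear_combination exp (-(Real.pi * I * τ)) ^ 2 * this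

/-- The extra terms `-2πi θ₁` from the derivatives cancel in the antisymmetric combination of `a`
and `a + b + c`. -/
lemma thetaDefect_add_self {τ : ℂ} (hτ : 0 < τ.im) (a b c : ℂ) :
    thetaDefect τ (a + τ) b c =
      thetaFactor τ a * thetaFactor τ (a + (b + c)) * thetaDefect τ a b c := by
  simp only [thetaDefect, add_right_comm a τ, theta1_add_self hτ, deriv_theta1_add_self hτ]
  linear_combination (deriv (theta1 τ) 0 * theta1 τ (a + b) * theta1 τ (a + c) *
    theta1 τ (b + c)) * thetaFactor_mul_thetaFactor τ a b c

lemma thetaDefect_of_left_zero {τ : ℂ} (hτ : 0 < τ.im) {a : ℂ} (b c : ℂ)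
    (ha : theta1 τ a = 0) : thetaDefect τ a b c = 0 := by
  obtain ⟨m, n, rfl⟩ := (theta1_eq_zero_iff hτ a).1 ha
  have h := (lattice_translate_iff (τ := τ) (p := fun u => thetaDefect τ u b c = 0)
    (fun u => by rw [thetaDefect_add_one hτ])
    (fun u => by rw [thetaDefect_add_self hτ, mul_eq_zero, or_iff_right (mul_ne_zero
      (thetaFactor_ne_zero τ u) (thetaFactor_ne_zero _ _))]) m n 0).2
  rw [zero_add] at h
  apply h
  simp only [thetaDefect, zero_add, theta1_zero τ hτ]
  ring

lemma thetaDefect_of_sum_zero {τ : ℂ} (hτ : 0 < τ.im) {a b c : ℂ}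
    (ha : theta1 τ (a + (b + c)) = 0) : thetaDefect τ a b c = 0 := by
  obtain ⟨m, n, hmn⟩ := (theta1_eq_zero_iff hτ _).1 ha
  have h := (lattice_translate_iff (τ := τ) (p := fun u => thetaDefect τ u b c = 0)
    (fun u => by rw [thetaDefect_add_one hτ])
    (fun u => by rw [thetaDefect_add_self hτ, mul_eq_zero, or_iff_right (mul_ne_zero
      (thetaFactor_ne_zero τ u) (thetaFactor_ne_zero _ _))]) m n (-(b + c))).2
  rw [show a = -(b + c) + m + n * τ by linear_combination hmn]
  apply h
  simp only [thetaDefect, neg_add_cancel, theta1_zero τ hτ,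
    show -(b + c) + b = -c by ring, show -(b + c) + c = -b by ring, theta1_neg hτ]
  ring

lemma differentiable_thetaDefect_left {τ : ℂ} (hτ : 0 < τ.im) (b c : ℂ) :
    Differentiable ℂ fun a => thetaDefect τ a b c := by
  have h1 := differentiable_theta1 hτ
  have h2 := differentiable_deriv_theta1 hτ
  unfold thetaDefect
  fun_prop

lemma differentiable_thetaDefect_right {τ : ℂ} (hτ : 0 < τ.im) (a b : ℂ) :
    Differentiable ℂ fun c => thetaDefect τ a b c := by
  have h1 := differentiable_theta1 hτ
  have h2 := differentiable_deriv_theta1 hτ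
  unfold thetaDefect
  fun_prop

/-- An entire function vanishing off the zeros of a nonzero entire function vanishes. -/
lemma eq_zero_of_mul_eq_zero {F P : ℂ → ℂ} (hF : Differentiable ℂ F) (hP : Differentiable ℂ P)
    (hne : ∃ u, P u ≠ 0) (h : ∀ u, F u * P u = 0) (u : ℂ) : F u = 0 := by
  have hF' : AnalyticOnNhd ℂ F Set.univ := fun u _ => hF.analyticAt u
  have hP' : AnalyticOnNhd ℂ P Set.univ := fun u _ => hP.analyticAt u
  rcases hF'.eq_zero_or_eq_zero_of_mul_eq_zero hP' (fun u _ => h u) isPreconnected_univ with h | h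
  · exact h u trivial
  · obtain ⟨v, hv⟩ := hne
    exact absurd (h v trivial) hv

lemma exists_theta1_mul_ne_zero {τ : ℂ} (hτ : 0 < τ.im) (s : ℂ) :
    ∃ u, theta1 τ u * theta1 τ (u + s) ≠ 0 := by
  have hd := differentiable_theta1 hτ
  have h0 : ∃ u, theta1 τ u ≠ 0 := by
    by_contra! h
    exact deriv_theta1_zero_ne_zero hτ (by rw [funext h]; simp)
  by_contra! h
  obtain ⟨v, hv⟩ := h0
  refine hv (eq_zero_of_mul_eq_zero hd (P := fun u => theta1 τ (u + s)) (by fun_prop)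
    ⟨v - s, by simpa using hv⟩ h v)

/-- As a function of `a`, the defect has the same multipliers as `θ₁(a) θ₁(a+b+c)` and vanishes at
all its zeros, which are simple because `b + c` is not a lattice point. The quotient is thus entire
and elliptic, hence constant, and it is zero at `a = -b`. -/
lemma thetaDefect_eq_zero_of_ne {τ : ℂ} (hτ : 0 < τ.im) (a : ℂ) {b c : ℂ}
    (hb : theta1 τ b ≠ 0) (hc : theta1 τ c ≠ 0) (hbc : theta1 τ (b + c) ≠ 0) :
    thetaDefect τ a b c = 0 := by
  have hd := differentiable_theta1 hτ
  have hP : Differentiable ℂ fun u => theta1 τ u * theta1 τ (u + (b + c)) := by fun_prop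
  obtain ⟨G, hG, hGP⟩ := exists_differentiable_eq_mul (differentiable_thetaDefect_left hτ b c) hP
    (fun u hu => by
      have hder : deriv (fun u => theta1 τ u * theta1 τ (u + (b + c))) u =
          deriv (theta1 τ) u * theta1 τ (u + (b + c)) +
            theta1 τ u * deriv (theta1 τ) (u + (b + c)) := by
        rw [deriv_fun_mul (hd u) (by fun_prop), deriv_comp_add_const]
      have hnot : ¬(theta1 τ u = 0 ∧ theta1 τ (u + (b + c)) = 0) := fun h =>
        hbc (by simpa using theta1_sub_eq_zero hτ h.2 h.1)
      rw [hder]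
      rcases mul_eq_zero.1 hu with h | h
      · refine ⟨thetaDefect_of_left_zero hτ b c h, ?_⟩
        rw [h, zero_mul, add_zero]
        exact mul_ne_zero (deriv_theta1_ne_zero hτ h) fun h' => hnot ⟨h, h'⟩
      · refine ⟨thetaDefect_of_sum_zero hτ h, ?_⟩
        rw [h, mul_zero, zero_add]
        exact mul_ne_zero (fun h' => hnot ⟨h', h⟩) (deriv_theta1_ne_zero hτ h))
  have hne := exists_theta1_mul_ne_zero hτ (b + c)
  have hG1 : ∀ u, G (u + 1) = G u := fun u => sub_eq_zero.1 <|
    eq_zero_of_mul_eq_zero (F := fun u => G (u + 1) - G u) (by fun_prop) hP hne (fun u => by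
      have h := hGP (u + 1)
      simp only [thetaDefect_add_one hτ, hGP u, add_right_comm u 1, theta1_add_one hτ] at h
      linear_combination -h) u
  have hGτ : ∀ u, G (u + τ) = G u := fun u => sub_eq_zero.1 <|
    eq_zero_of_mul_eq_zero (F := fun u => G (u + τ) - G u) (by fun_prop) hP hne (fun u => by
      have h := hGP (u + τ)
      simp only [thetaDefect_add_self hτ, hGP u, add_right_comm u τ, theta1_add_self hτ] at h
      refine mul_left_cancel₀ (mul_ne_zero (thetaFactor_ne_zero τ u)
        (thetaFactor_ne_zero τ (u + (b + c)))) ?_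
      linear_combination -h) u
  have hGb : G (-b) = 0 := by
    have h := hGP (-b)
    simp only [thetaDefect, neg_add_cancel, neg_add_cancel_left, theta1_zero τ hτ,
      theta1_neg hτ, deriv_theta1_neg hτ] at h
    refine (mul_eq_zero.1 (h.symm.trans ?_)).resolve_left
      (mul_ne_zero (neg_ne_zero.2 hb) hc)
    ring
  rw [hGP a, eq_of_differentiable_of_periodic hτ hG hG1 hGτ a (-b), hGb, mul_zero]

/-- The identity theorem in `c` removes the conditions on `c` and `b + c`. Regularity of `ξ` does
not keep `ξ 1 + ξ 2` off the lattice, so this is needed. -/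
lemma thetaDefect_eq_zero {τ : ℂ} (hτ : 0 < τ.im) (a : ℂ) {b : ℂ} (c : ℂ)
    (hb : theta1 τ b ≠ 0) : thetaDefect τ a b c = 0 := by
  have hd := differentiable_theta1 hτ
  refine eq_zero_of_mul_eq_zero (differentiable_thetaDefect_right hτ a b)
    (P := fun u => theta1 τ u * theta1 τ (u + b)) (by fun_prop)
    (exists_theta1_mul_ne_zero hτ b) (fun c => ?_) c
  by_cases hc : theta1 τ c = 0
  · rw [hc, zero_mul, mul_zero]
  by_cases hbc : theta1 τ (c + b) = 0
  · rw [hbc, mul_zero, mul_zero]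
  rw [thetaDefect_eq_zero_of_ne hτ a hb hc (by rwa [add_comm]), zero_mul]

/-- For `∑ ξ_A = 0`, the product of theta functions is a sum of logarithmic derivatives. -/
lemma eta_mul_theta1_eq_sum_thetaLog {τ : ℂ} (hτ : 0 < τ.im) {ξ : Fin 4 → ℂ}
    (hξ : ∑ A, ξ A = 0) (hreg : Regular τ ξ) :
    Complex.I * ModularForm.eta τ ^ 3 *
        (theta1 τ (ξ 0 + ξ 3) * theta1 τ (ξ 1 + ξ 3) * theta1 τ (ξ 2 + ξ 3)) /
        ∏ A, theta1 τ (ξ A) = ∑ A, thetaLog τ (ξ A) := by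
  rw [Fin.sum_univ_four] at hξ
  have hne : ∏ A, theta1 τ (ξ A) ≠ 0 := Finset.prod_ne_zero_iff.2 fun A _ => hreg A
  rw [div_eq_iff hne, Fin.sum_univ_four, Fin.prod_univ_four]
  have h := thetaDefect_eq_zero hτ (ξ 0) (ξ 2) (hreg 1)
  have e3 : ξ 0 + (ξ 1 + ξ 2) = -ξ 3 := by linear_combination hξ
  have e0 : ξ 1 + ξ 2 = -(ξ 0 + ξ 3) := by linear_combination hξ
  have e1 : ξ 0 + ξ 2 = -(ξ 1 + ξ 3) := by linear_combination hξ
  have e2 : ξ 0 + ξ 1 = -(ξ 2 + ξ 3) := by linear_combination hξ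
  rw [thetaDefect, e3, e0, e1, e2] at h
  simp only [theta1_neg hτ, deriv_theta1_neg hτ, (hasDerivAt_theta1_zero hτ).deriv,
    deriv_theta1_eq hτ (hreg _)] at h
  have hpi : (2 * Real.pi * I : ℂ) ≠ 0 := two_pi_I_ne_zero
  refine mul_left_cancel₀ hpi ?_
  linear_combination h + 2 * Real.pi * ModularForm.eta τ ^ 3 *
    (theta1 τ (ξ 0 + ξ 3) * theta1 τ (ξ 1 + ξ 3) * theta1 τ (ξ 2 + ξ 3)) * I_sq

/-! ### Averages over roots of unity and the Hecke sum -/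

/-- Gives a denominator that does not change when `Y` is multiplied by a `k`-th root of unity. -/
lemma geomTail_eq_sum_div {Y : ℂ} {k : ℕ} (h : Y ^ k ≠ 1) :
    geomTail Y = (∑ j ∈ Finset.range k, Y ^ (j + 1)) / (1 - Y ^ k) := by
  have hY : Y ≠ 1 := by rintro rfl; simp at h
  have h1 : 1 - Y ≠ 0 := sub_ne_zero.2 hY.symm
  have h2 : 1 - Y ^ k ≠ 0 := sub_ne_zero.2 h.symm
  simp only [pow_succ, ← Finset.sum_mul]
  rw [geomTail, div_eq_div_iff h1 h2]
  linear_combination Y * geom_sum_mul Y k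

lemma sum_geomTail_mul_pow {ζ : ℂ} {k a : ℕ} (hζ : IsPrimitiveRoot ζ k) (hk : 0 < k)
    (hka : k ∣ a) {X : ℂ} (hX : X ^ k ≠ 1) :
    ∑ b ∈ Finset.range a, geomTail (X * ζ ^ b) = a * geomTail (X ^ k) := by
  have hpow : ∀ b, (X * ζ ^ b) ^ k = X ^ k := fun b => by
    rw [mul_pow, ← pow_mul, mul_comm b, pow_mul, hζ.pow_eq_one, one_pow, mul_one]
  have hterm : ∀ b, geomTail (X * ζ ^ b) =
      (∑ j ∈ Finset.range k, X ^ (j + 1) * (ζ ^ (j + 1)) ^ b) / (1 - X ^ k) := fun b => by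
    rw [geomTail_eq_sum_div (k := k) (by rwa [hpow]), hpow]
    congr 1
    refine Finset.sum_congr rfl fun j _ => ?_
    rw [mul_pow, ← pow_mul, ← pow_mul, mul_comm b]
  -- Orthogonality: the exponents `j + 1` run over `1, …, k`, and only `k` is divisible by the order
  -- `k` of `ζ`.
  have hinner : ∀ j ∈ Finset.range k, ∑ b ∈ Finset.range a, X ^ (j + 1) * (ζ ^ (j + 1)) ^ b =
      if j = k - 1 then (a : ℂ) * X ^ k else 0 := fun j hj => by
    have hj' := Finset.mem_range.1 hj
    rw [← Finset.mul_sum]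
    split_ifs with h
    · have hjk : j + 1 = k := by omega
      simp only [hjk, hζ.pow_eq_one, one_pow, Finset.sum_const, Finset.card_range]
      simp [mul_comm]
    · have hne : ζ ^ (j + 1) ≠ 1 := fun h1 => by
        have := Nat.le_of_dvd (by omega) ((hζ.pow_eq_one_iff_dvd _).1 h1)
        omega
      have hone : (ζ ^ (j + 1)) ^ a = 1 := by
        rw [← pow_mul, mul_comm, pow_mul, (hζ.pow_eq_one_iff_dvd a).2 hka, one_pow]
      rw [geom_sum_eq hne, hone, sub_self, zero_div, mul_zero]
  simp only [hterm]
  rw [← Finset.sum_div, Finset.sum_comm, Finset.sum_congr rfl hinner,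
    Finset.sum_ite_eq_of_mem' _ _ _ (Finset.mem_range.2 (by omega)), geomTail, mul_div_assoc]

lemma isPrimitiveRoot_expTwoPiI_pow {a : ℕ} (ha : 0 < a) (n : ℕ) :
    IsPrimitiveRoot (expTwoPiI (1 / a) ^ n) (a / n.gcd a) := by
  have h : IsPrimitiveRoot (expTwoPiI (1 / a)) a := by
    have := Complex.isPrimitiveRoot_exp a ha.ne'
    rwa [expTwoPiI, mul_one_div]
  have hfin : IsOfFinOrder (expTwoPiI (1 / a)) := isOfFinOrder_iff_pow_eq_one.2 ⟨a, ha, h.pow_eq_one⟩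
  have := IsPrimitiveRoot.orderOf (expTwoPiI (1 / a) ^ n)
  rwa [hfin.orderOf_pow, ← h.eq_orderOf, Nat.gcd_comm] at this

lemma summable_prod_of_fintype {ι : Type*} [Finite ι] {F : ι × ℕ → ℂ}
    (h : ∀ i, Summable fun n => F (i, n)) : Summable F := by
  rw [← summable_norm_iff, summable_prod_of_nonneg fun _ => norm_nonneg _]
  exact ⟨fun i => (h i).norm, Summable.of_finite⟩

lemma sum_tsum_eq_tsum_prod (s : Finset ℕ) {F : ℕ → ℕ → ℂ}
    (h : Summable fun p : s × ℕ => F p.1 p.2) :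
    ∑ i ∈ s, ∑' n, F i n = ∑' p : s × ℕ, F p.1 p.2 := by
  rw [h.tsum_prod, tsum_fintype, ← Finset.sum_coe_sort s]

/-- With `g = gcd(n, a)`, write `n = n'g`, `a = a'g`, `N = a'gd`, where `n'` and `a'` are coprime.
The pair `(a, n)` goes to `(a'd, n'd)`, whose gcd is `d`: the map exchanges `g` and `d`, so applying
it twice is the identity. -/
lemma divisors_swap_aux {N a n : ℕ} (hN : N ≠ 0) (ha : a ∣ N) :
    N / n.gcd a ∣ N ∧ N / (n / n.gcd a * (N / a)).gcd (N / n.gcd a) = a ∧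
      n / n.gcd a * (N / a) / (n / n.gcd a * (N / a)).gcd (N / n.gcd a) * (N / (N / n.gcd a)) =
        n := by
  obtain ⟨d, rfl⟩ := ha
  have ha0 : a ≠ 0 := left_ne_zero_of_mul hN
  have hd0 : d ≠ 0 := right_ne_zero_of_mul hN
  obtain ⟨g, n', a', hg, hco, hn, ha'⟩ := Nat.exists_coprime' (m := n) (n := a)
    (Nat.gcd_pos_of_pos_right _ (Nat.pos_of_ne_zero ha0))
  subst hn ha'
  have ha'0 : a' ≠ 0 := left_ne_zero_of_mul ha0
  have e1 : (n' * g).gcd (a' * g) = g := by rw [Nat.gcd_mul_right, hco.gcd_eq_one, one_mul]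
  have e2 : a' * g * d / g = a' * d := by
    rw [mul_right_comm, Nat.mul_div_cancel _ hg]
  have e3 : a' * g * d / (a' * g) = d := Nat.mul_div_cancel_left _ (Nat.pos_of_ne_zero ha0)
  have e4 : (n' * d).gcd (a' * d) = d := by rw [Nat.gcd_mul_right, hco.gcd_eq_one, one_mul]
  have e5 : a' * g * d / (a' * d) = g := by
    rw [mul_right_comm]; exact Nat.mul_div_cancel_left _ (by positivity)
  rw [e1, e2, Nat.mul_div_cancel _ hg, e3, e4, e5, Nat.mul_div_cancel _ (Nat.pos_of_ne_zero hd0),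
    Nat.mul_div_cancel _ (Nat.pos_of_ne_zero hd0)]
  exact ⟨⟨g, by ring⟩, rfl, rfl⟩

/-- The involution `(a, n) ↦ (N / gcd (n, a), (n / gcd (n, a)) (N / a))`. -/
def divisorsSwap (N : ℕ) (p : N.divisors × ℕ) : N.divisors × ℕ :=
  (⟨N / p.2.gcd p.1, by
    have hN := (Nat.mem_divisors.1 p.1.2).2
    exact Nat.mem_divisors.2 ⟨(divisors_swap_aux hN (Nat.mem_divisors.1 p.1.2).1).1, hN⟩⟩,
    p.2 / p.2.gcd p.1 * (N / p.1))

lemma divisorsSwap_involutive (N : ℕ) : Function.Involutive (divisorsSwap N) := by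
  rintro ⟨⟨a, ha⟩, n⟩
  obtain ⟨ha, hN⟩ := Nat.mem_divisors.1 ha
  obtain ⟨-, h1, h2⟩ := divisors_swap_aux (n := n) hN ha
  exact Prod.ext (Subtype.ext h1) h2

lemma sum_divisors_tsum_swap (N : ℕ) {F : ℕ → ℕ → ℂ}
    (hF : ∀ e ∈ N.divisors, Summable (F e)) :
    ∑ d ∈ N.divisors, ∑' n : ℕ, F (N / n.gcd (N / d)) (n / n.gcd (N / d) * d) =
      ∑ e ∈ N.divisors, ∑' m : ℕ, F e m := by
  have hs : Summable fun p : N.divisors × ℕ => F p.1 p.2 :=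
    summable_prod_of_fintype fun i => hF i i.2
  have hs' := ((divisorsSwap_involutive N).toPerm.summable_iff).2 hs
  have ht := ((divisorsSwap_involutive N).toPerm).tsum_eq fun p : N.divisors × ℕ => F p.1 p.2
  rw [sum_tsum_eq_tsum_prod _ hs, ← ht]
  refine Eq.trans ?_ (sum_tsum_eq_tsum_prod N.divisors
    (F := fun a n => F (N / n.gcd a) (n / n.gcd a * (N / a))) hs')
  -- Replaces the summation variable `d` by the complementary divisor `a = N/d`, on which the
  -- involution acts.
  rw [← Nat.sum_div_divisors]
  refine Finset.sum_congr rfl fun d hd => ?_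
  obtain ⟨hd, hN⟩ := Nat.mem_divisors.1 hd
  rw [Nat.div_div_self hd hN]

lemma expTwoPiI_mul_pow_ne_one {τ : ℂ} (hτ : 0 < τ.im) {u : ℂ} (hu : theta1 τ u ≠ 0) (m : ℕ) :
    expTwoPiI u * expTwoPiI τ ^ m ≠ 1 := by
  rw [← expTwoPiI_natCast_mul, ← expTwoPiI_add, Ne, expTwoPiI_eq_one_iff]
  rintro ⟨k, hk⟩
  refine hu ((theta1_eq_zero_iff hτ u).2 ⟨k, -m, ?_⟩)
  push_cast
  linear_combination hk

/-- Adding and subtracting the term `z/(1-z)` lets both series start at `n = 0`, in the range on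
which `divisorsSwap` acts. -/
lemma thetaLog_eq_tsum {τ : ℂ} (hτ : 0 < τ.im) (u : ℂ) :
    thetaLog τ u = -(1 / 2) - geomTail (expTwoPiI u) +
      ∑' n : ℕ, (geomTail (expTwoPiI u * expTwoPiI τ ^ n) -
        geomTail ((expTwoPiI u)⁻¹ * expTwoPiI τ ^ n)) := by
  have hq := norm_expTwoPiI_lt_one hτ
  have h1 := summable_geomTail hq (expTwoPiI u)
  rw [h1.tsum_sub (summable_geomTail hq _), h1.tsum_eq_zero_add, thetaLog]
  simp only [pow_zero, mul_one, pow_succ', mul_assoc]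
  ring

lemma im_hecke_pos {τ : ℂ} (hτ : 0 < τ.im) {d a : ℕ} (hd : 0 < d) (ha : 0 < a) (b : ℕ) :
    0 < (((d : ℂ) * τ + b) / (a : ℂ)).im := by
  have h : (((d : ℂ) * τ + b) / (a : ℂ)).im = d * τ.im / a := by
    rw [← Complex.ofReal_natCast a, Complex.div_ofReal_im]
    simp
  rw [h]
  positivity

/-- In the `n`-th term `b` enters only through `e^(2πi n b/a)`, a power of a root of unity of exact
order `a / gcd(n, a)`. -/
lemma sum_geomTail_hecke {τ : ℂ} {d a : ℕ} (ha : 0 < a) (x : ℂ) (n : ℕ)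
    (h : x ^ (a / n.gcd a) * expTwoPiI τ ^ (n / n.gcd a * d) ≠ 1) :
    ∑ b ∈ Finset.range a, geomTail (x * expTwoPiI (((d : ℂ) * τ + b) / (a : ℂ)) ^ n) =
      a * geomTail (x ^ (a / n.gcd a) * expTwoPiI τ ^ (n / n.gcd a * d)) := by
  have ha' : (a : ℂ) ≠ 0 := Nat.cast_ne_zero.2 ha.ne'
  have hg : 0 < n.gcd a := Nat.gcd_pos_of_pos_right _ ha
  have hQ : expTwoPiI (d * τ / a) ^ (n * (a / n.gcd a)) =
      expTwoPiI τ ^ (n / n.gcd a * d) := by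
    have : n * (a / n.gcd a) = a * (n / n.gcd a) := by
      rw [← Nat.mul_div_assoc _ (Nat.gcd_dvd_right n a),
        ← Nat.mul_div_assoc _ (Nat.gcd_dvd_left n a), mul_comm]
    rw [this, pow_mul, ← expTwoPiI_natCast_mul, mul_div_cancel₀ _ ha', expTwoPiI_natCast_mul,
      ← pow_mul, mul_comm d]
  have hX : (x * expTwoPiI (d * τ / a) ^ n) ^ (a / n.gcd a) =
      x ^ (a / n.gcd a) * expTwoPiI τ ^ (n / n.gcd a * d) := by
    rw [mul_pow, ← pow_mul, hQ]
  rw [← hX, ← sum_geomTail_mul_pow (isPrimitiveRoot_expTwoPiI_pow ha n)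
    (Nat.div_pos (Nat.gcd_le_right _ ha) hg) (Nat.div_dvd_of_dvd (Nat.gcd_dvd_right n a))
    (by rwa [hX])]
  refine Finset.sum_congr rfl fun b _ => ?_
  rw [add_div, expTwoPiI_add, mul_pow, show (b : ℂ) / a = b * (1 / a) by ring,
    expTwoPiI_natCast_mul, ← pow_mul, ← pow_mul, mul_comm b n, mul_assoc]

/-- The Hecke sums of the logarithmic derivative of `theta1` collapse to its multiples. -/
lemma hecke_sum_thetaLog {τ : ℂ} (hτ : 0 < τ.im) {N : ℕ} (hN : N ≠ 0) {u : ℂ}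
    (hu : ∀ d ∈ N.divisors, theta1 τ (d * u) ≠ 0) :
    ∑ d ∈ N.divisors, ∑ b ∈ Finset.range (N / d),
        (d : ℂ) * thetaLog (((d : ℂ) * τ + b) / ((N / d : ℕ) : ℂ)) (d * u) =
      N * ∑ d ∈ N.divisors, thetaLog τ (d * u) := by
  set z := expTwoPiI u with hz
  set q := expTwoPiI τ with hq'
  have hq : ‖q‖ < 1 := norm_expTwoPiI_lt_one hτ
  let F : ℕ → ℕ → ℂ := fun e m => geomTail (z ^ e * q ^ m) - geomTail ((z ^ e)⁻¹ * q ^ m)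
  have hF : ∀ e ∈ N.divisors, Summable (F e) := fun e _ =>
    (summable_geomTail hq _).sub (summable_geomTail hq _)
  have hfac : ∀ e ∈ N.divisors, ∀ m : ℕ, z ^ e * q ^ m ≠ 1 ∧ (z ^ e)⁻¹ * q ^ m ≠ 1 :=
    fun e he m => by
      rw [hz, ← expTwoPiI_natCast_mul, ← expTwoPiI_neg]
      refine ⟨expTwoPiI_mul_pow_ne_one hτ (hu e he) m, expTwoPiI_mul_pow_ne_one hτ ?_ m⟩
      rw [theta1_neg hτ]
      exact neg_ne_zero.2 (hu e he)
  have hright : ∀ d : ℕ, thetaLog τ (d * u) = -(1 / 2) - geomTail (z ^ d) + ∑' n, F d n :=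
    fun d => by rw [thetaLog_eq_tsum hτ, expTwoPiI_natCast_mul]
  -- The part outside the series does not depend on `b`, so it is counted `N/d` times; together with
  -- the weight `d` this is the common factor `N`. The series acquires the same factor from the
  -- averages.
  have hleft : ∀ d ∈ N.divisors, ∑ b ∈ Finset.range (N / d),
      (d : ℂ) * thetaLog (((d : ℂ) * τ + b) / ((N / d : ℕ) : ℂ)) (d * u) =
      N * (-(1 / 2) - geomTail (z ^ d) +
        ∑' n : ℕ, F (N / n.gcd (N / d)) (n / n.gcd (N / d) * d)) := by
    intro d hd
    have hdN := (Nat.mem_divisors.1 hd).1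
    have hd0 : 0 < d := Nat.pos_of_mem_divisors hd
    have ha0 : 0 < N / d := Nat.div_pos (Nat.le_of_dvd (Nat.pos_of_ne_zero hN) hdN) hd0
    have hda : (d : ℂ) * (N / d : ℕ) = N := by exact_mod_cast Nat.mul_div_cancel' hdN
    have him : ∀ b : ℕ, 0 < (((d : ℂ) * τ + b) / ((N / d : ℕ) : ℂ)).im :=
      fun b => im_hecke_pos hτ hd0 ha0 b
    simp only [fun b => thetaLog_eq_tsum (him b), expTwoPiI_natCast_mul, ← hz]
    rw [← Finset.mul_sum, Finset.sum_add_distrib, ← Summable.tsum_finsetSum fun b _ =>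
      (summable_geomTail (norm_expTwoPiI_lt_one (him b)) _).sub
        (summable_geomTail (norm_expTwoPiI_lt_one (him b)) _)]
    have hterm : ∀ n : ℕ, ∑ b ∈ Finset.range (N / d),
        (geomTail (z ^ d * expTwoPiI (((d : ℂ) * τ + b) / ((N / d : ℕ) : ℂ)) ^ n) -
        geomTail ((z ^ d)⁻¹ * expTwoPiI (((d : ℂ) * τ + b) / ((N / d : ℕ) : ℂ)) ^ n)) =
        (N / d : ℕ) * F (N / n.gcd (N / d)) (n / n.gcd (N / d) * d) := by
      intro n
      have hgd : n.gcd (N / d) ∣ N / d := Nat.gcd_dvd_right _ _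
      have he : d * ((N / d) / n.gcd (N / d)) = N / n.gcd (N / d) := by
        rw [← Nat.mul_div_assoc _ hgd, Nat.mul_div_cancel' hdN]
      have hmem : N / n.gcd (N / d) ∈ N.divisors := Nat.mem_divisors.2
        ⟨Nat.div_dvd_of_dvd (hgd.trans (Nat.div_dvd_of_dvd hdN)), hN⟩
      obtain ⟨hn1, hn2⟩ := hfac _ hmem (n / n.gcd (N / d) * d)
      have e1 : (z ^ d) ^ ((N / d) / n.gcd (N / d)) = z ^ (N / n.gcd (N / d)) := by
        rw [← pow_mul, he]
      have e2 : ((z ^ d)⁻¹) ^ ((N / d) / n.gcd (N / d)) = (z ^ (N / n.gcd (N / d)))⁻¹ := by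
        rw [inv_pow, e1]
      rw [Finset.sum_sub_distrib, sum_geomTail_hecke ha0 _ _ (by rwa [e1]),
        sum_geomTail_hecke ha0 _ _ (by rwa [e2]), e1, e2, ← mul_sub]
    simp only [hterm]
    rw [tsum_mul_left, Finset.sum_const, Finset.card_range, nsmul_eq_mul, ← mul_add, ← mul_assoc,
      hda]
  rw [Finset.sum_congr rfl hleft, ← Finset.mul_sum, Finset.sum_add_distrib,
    sum_divisors_tsum_swap N hF, ← Finset.sum_add_distrib]
  simp only [hright]

/-! ### The index of the single sigma model and its Hecke sums -/

/-- The theta quotient to which the index `I₁` evaluates. -/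
def thetaQuotient (τ : ℂ) (ξ : Fin 4 → ℂ) : ℂ :=
  Complex.I * ModularForm.eta τ ^ 3 *
    (theta1 τ (ξ 0 + ξ 3) * theta1 τ (ξ 1 + ξ 3) * theta1 τ (ξ 2 + ξ 3)) / ∏ A, theta1 τ (ξ A)

/-- Shifting all `ξ A` by `t/2` moves only the first spinor coordinate; the sum-zero condition turns
the other three into `ξ_B + ξ_4`. -/
lemma prod_theta1_spinor_shift (τ : ℂ) {ξ : Fin 4 → ℂ} (hξ : ∑ A, ξ A = 0) (t : ℂ) :
    ∏ A, theta1 τ (spinorMatrix.mulVec (fun A => ξ A + 1 / 2 * t) A) =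
      theta1 τ t * (theta1 τ (ξ 0 + ξ 3) * theta1 τ (ξ 1 + ξ 3) * theta1 τ (ξ 2 + ξ 3)) := by
  rw [Fin.sum_univ_four] at hξ
  have h0 : spinorMatrix.mulVec (fun A => ξ A + 1 / 2 * t) 0 = t := by
    simp [spinorMatrix, Matrix.mulVec, dotProduct, Fin.sum_univ_four]
    linear_combination (1 / 2) * hξ
  have h1 : spinorMatrix.mulVec (fun A => ξ A + 1 / 2 * t) 1 = ξ 0 + ξ 3 := by
    simp [spinorMatrix, Matrix.mulVec, dotProduct, Fin.sum_univ_four]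
    linear_combination (-1 / 2) * hξ
  have h2 : spinorMatrix.mulVec (fun A => ξ A + 1 / 2 * t) 2 = ξ 1 + ξ 3 := by
    simp [spinorMatrix, Matrix.mulVec, dotProduct, Fin.sum_univ_four]
    linear_combination (-1 / 2) * hξ
  have h3 : spinorMatrix.mulVec (fun A => ξ A + 1 / 2 * t) 3 = ξ 2 + ξ 3 := by
    simp [spinorMatrix, Matrix.mulVec, dotProduct, Fin.sum_univ_four]
    linear_combination (-1 / 2) * hξ
  rw [Fin.prod_univ_four, h0, h1, h2, h3]
  ring

lemma Z1_shift_zero {τ : ℂ} (hτ : 0 < τ.im) {ξ : Fin 4 → ℂ} (hξ : ∑ A, ξ A = 0) :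
    Z1 τ (fun A => ξ A + 1 / 2 * 0) = 0 := by
  rw [Z1, prod_theta1_spinor_shift τ hξ, theta1_zero τ hτ, zero_mul, zero_div]

lemma hasDerivAt_Z1_shift {τ : ℂ} (hτ : 0 < τ.im) {ξ : Fin 4 → ℂ} (hξ : ∑ A, ξ A = 0)
    (hreg : Regular τ ξ) :
    HasDerivAt (fun t : ℂ => Z1 τ (fun A => ξ A + 1 / 2 * t))
      (-(2 * Real.pi * I) * thetaQuotient τ ξ) 0 := by
  have hd := differentiable_theta1 hτ
  have hne : ∏ A, theta1 τ (ξ A) ≠ 0 := Finset.prod_ne_zero_iff.2 fun A _ => hreg A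
  have hden : Differentiable ℂ fun t : ℂ => ∏ A, theta1 τ (ξ A + 1 / 2 * t) := by
    simp only [Fin.prod_univ_four]
    fun_prop
  have hnum := (hasDerivAt_theta1_zero hτ).mul_const
    (theta1 τ (ξ 0 + ξ 3) * theta1 τ (ξ 1 + ξ 3) * theta1 τ (ξ 2 + ξ 3))
  have h := hnum.div (hden 0).hasDerivAt (by simpa using hne)
  have hZ : (fun t : ℂ => Z1 τ (fun A => ξ A + 1 / 2 * t)) = fun t =>
      theta1 τ t * (theta1 τ (ξ 0 + ξ 3) * theta1 τ (ξ 1 + ξ 3) * theta1 τ (ξ 2 + ξ 3)) /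
        ∏ A, theta1 τ (ξ A + 1 / 2 * t) := by
    funext t
    rw [Z1, prod_theta1_spinor_shift τ hξ]
  rw [hZ]
  convert! h using 1
  simp only [theta1_zero τ hτ, mul_zero, add_zero, zero_mul, sub_zero, thetaQuotient]
  field_simp
  linear_combination (-(ModularForm.eta τ ^ 3 * theta1 τ (ξ 0 + ξ 3) * theta1 τ (ξ 1 + ξ 3) *
    theta1 τ (ξ 2 + ξ 3))) * I_sq

lemma hasDerivAt_log_div (d : ℂ) :
    HasDerivAt (fun b : ℂ => d * (log b / (2 * Real.pi * I))) (d / (2 * Real.pi * I)) 1 := by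
  have h := ((hasDerivAt_log (z := 1) (by simp)).div_const (2 * Real.pi * I)).const_mul d
  convert! h using 1
  rw [inv_one]
  ring

/-- Scaling `ξ` by `d` scales the shift `t` by `d`. This is the source of the weight `d`, while the
`2πi` of the logarithm cancels the one from the shift derivative. -/
lemma hasDerivAt_Z1_withB1 {τ : ℂ} (hτ : 0 < τ.im) {ξ : Fin 4 → ℂ} (hξ : ∑ A, ξ A = 0) (d : ℂ)
    (hreg : Regular τ (fun A => d * ξ A)) :
    HasDerivAt (fun b : ℂ => Z1 τ (fun A => d * withB1 ξ b A))
      (-(d * thetaQuotient τ (fun A => d * ξ A))) 1 := by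
  have hξ' : ∑ A, d * ξ A = 0 := by rw [← Finset.mul_sum, hξ, mul_zero]
  have hg := hasDerivAt_Z1_shift hτ hξ' hreg
  have hlog := hasDerivAt_log_div d
  have h := HasDerivAt.comp_of_eq (1 : ℂ) hg hlog (by simp)
  have hfun : (fun b : ℂ => Z1 τ (fun A => d * withB1 ξ b A)) =
      (fun t : ℂ => Z1 τ (fun A => d * ξ A + 1 / 2 * t)) ∘
        fun b : ℂ => d * (log b / (2 * Real.pi * I)) := by
    funext b
    simp only [Function.comp, withB1]
    congr 1
    funext A
    ring
  rw [hfun]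
  convert! h using 1
  have := two_pi_I_ne_zero
  field_simp

lemma hasDerivAt_Z1_withB1_one {τ : ℂ} (hτ : 0 < τ.im) {ξ : Fin 4 → ℂ} (hξ : ∑ A, ξ A = 0)
    (hreg : Regular τ ξ) :
    HasDerivAt (fun b : ℂ => Z1 τ (withB1 ξ b)) (-thetaQuotient τ ξ) 1 := by
  simpa using hasDerivAt_Z1_withB1 hτ hξ 1 (by simpa using hreg)

lemma I1_eq_thetaQuotient {τ : ℂ} (hτ : 0 < τ.im) {ξ : Fin 4 → ℂ} (hξ : ∑ A, ξ A = 0)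
    (hreg : Regular τ ξ) : I1 τ ξ = thetaQuotient τ ξ := by
  rw [I1, indexOp, (hasDerivAt_Z1_withB1_one hτ hξ hreg).deriv, neg_neg]

lemma I1_eq_sum_thetaLog {τ : ℂ} (hτ : 0 < τ.im) {ξ : Fin 4 → ℂ} (hξ : ∑ A, ξ A = 0)
    (hreg : Regular τ ξ) : I1 τ ξ = ∑ A, thetaLog τ (ξ A) :=
  (I1_eq_thetaQuotient hτ hξ hreg).trans (eta_mul_theta1_eq_sum_thetaLog hτ hξ hreg)

lemma im_hecke_pos_of_mem_divisors {τ : ℂ} (hτ : 0 < τ.im) {N d : ℕ} (hd : d ∈ N.divisors)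
    (b : ℕ) : 0 < (((d : ℂ) * τ + b) / ((N / d : ℕ) : ℂ)).im :=
  im_hecke_pos hτ (Nat.pos_of_mem_divisors hd) (Nat.div_pos (Nat.divisor_le hd)
    (Nat.pos_of_mem_divisors hd)) b

/-- The weighted Hecke sum of `I₁` collapses to its value at the multiples of `ξ`. -/
lemma hecke_sum_I1 {τ : ℂ} (hτ : 0 < τ.im) {N : ℕ} (hN : N ≠ 0) {ξ : Fin 4 → ℂ}
    (hξ : ∑ A, ξ A = 0) (hH : HeckeRegular N τ ξ)
    (hreg : ∀ d ∈ N.divisors, Regular τ (fun A => (d : ℂ) * ξ A)) :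
    (1 / (N : ℂ)) * ∑ d ∈ N.divisors, ∑ b ∈ Finset.range (N / d),
        (d : ℂ) * I1 (((d : ℂ) * τ + b) / ((N / d : ℕ) : ℂ)) (fun A => (d : ℂ) * ξ A)
      = ∑ d ∈ N.divisors, I1 τ (fun A => (d : ℂ) * ξ A) := by
  have hξ' : ∀ d : ℂ, ∑ A, d * ξ A = 0 := fun d => by rw [← Finset.mul_sum, hξ, mul_zero]
  have hN' : (N : ℂ) ≠ 0 := Nat.cast_ne_zero.2 hN
  have hl : ∑ d ∈ N.divisors, ∑ b ∈ Finset.range (N / d),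
      (d : ℂ) * I1 (((d : ℂ) * τ + b) / ((N / d : ℕ) : ℂ)) (fun A => (d : ℂ) * ξ A) =
      ∑ d ∈ N.divisors, ∑ b ∈ Finset.range (N / d), ∑ A,
        (d : ℂ) * thetaLog (((d : ℂ) * τ + b) / ((N / d : ℕ) : ℂ)) ((d : ℂ) * ξ A) :=
    Finset.sum_congr rfl fun d hd => Finset.sum_congr rfl fun b hb => by
      rw [I1_eq_sum_thetaLog (im_hecke_pos_of_mem_divisors hτ hd b) (hξ' d) (hH d hd b hb),
        Finset.mul_sum]
  have hr : ∑ d ∈ N.divisors, I1 τ (fun A => (d : ℂ) * ξ A) =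
      ∑ A, ∑ d ∈ N.divisors, thetaLog τ ((d : ℂ) * ξ A) := by
    rw [Finset.sum_comm]
    exact Finset.sum_congr rfl fun d hd => I1_eq_sum_thetaLog hτ (hξ' d) (hreg d hd)
  simp only [Finset.sum_comm (t := (Finset.univ : Finset (Fin 4)))] at hl
  rw [hl, hr, Finset.sum_congr rfl fun A _ =>
    hecke_sum_thetaLog hτ hN (u := ξ A) fun d hd => hreg d hd A, ← Finset.mul_sum, one_div,
    inv_mul_cancel_left₀ hN']

lemma hasDerivAt_heckeT {τ : ℂ} (hτ : 0 < τ.im) {M : ℕ} {ξ : Fin 4 → ℂ}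
    (hξ : ∑ A, ξ A = 0) (hH : HeckeRegular M τ ξ) :
    HasDerivAt (fun b : ℂ => heckeT M Z1 τ (withB1 ξ b))
      (-((1 / (M : ℂ)) * ∑ d ∈ M.divisors, ∑ b ∈ Finset.range (M / d),
        (d : ℂ) * I1 (((d : ℂ) * τ + b) / ((M / d : ℕ) : ℂ)) (fun A => (d : ℂ) * ξ A))) 1 := by
  have hξ' : ∀ d : ℂ, ∑ A, d * ξ A = 0 := fun d => by rw [← Finset.mul_sum, hξ, mul_zero]
  rw [← mul_neg, ← Finset.sum_neg_distrib]
  simp only [← Finset.sum_neg_distrib, heckeT]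
  refine HasDerivAt.const_mul _ (HasDerivAt.fun_sum fun d hd => HasDerivAt.fun_sum fun b hb => ?_)
  have him := im_hecke_pos_of_mem_divisors hτ hd b
  rw [I1_eq_thetaQuotient him (hξ' d) (hH d hd b hb)]
  exact hasDerivAt_Z1_withB1 him hξ d (hH d hd b hb)

lemma heckeT_withB1_one {τ : ℂ} (hτ : 0 < τ.im) (M : ℕ) {ξ : Fin 4 → ℂ} (hξ : ∑ A, ξ A = 0) :
    heckeT M Z1 τ (withB1 ξ 1) = 0 := by
  have hξ' : ∀ d : ℂ, ∑ A, d * ξ A = 0 := fun d => by rw [← Finset.mul_sum, hξ, mul_zero]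
  rw [heckeT, Finset.sum_eq_zero, mul_zero]
  intro d hd
  refine Finset.sum_eq_zero fun b _ => ?_
  have h := Z1_shift_zero (im_hecke_pos_of_mem_divisors hτ hd b) (hξ' d)
  simpa [withB1] using h

/-! ### Symmetric products: the exponential series -/

lemma coeff_pow_eq_zero_of_lt {S : PowerSeries ℂ} (hS : PowerSeries.constantCoeff S = 0)
    {N k : ℕ} (h : N < k) : PowerSeries.coeff N (S ^ k) = 0 :=
  PowerSeries.X_pow_dvd_iff.1 (pow_dvd_pow_of_dvd (PowerSeries.X_dvd_iff.2 hS) k) N h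

lemma coeff_exp_subst {S : PowerSeries ℂ} (hS : PowerSeries.constantCoeff S = 0) (N : ℕ) :
    PowerSeries.coeff N ((PowerSeries.exp ℂ).subst S : PowerSeries ℂ) =
      ∑ k ∈ Finset.range (N + 1),
        PowerSeries.coeff k (PowerSeries.exp ℂ) * PowerSeries.coeff N (S ^ k) := by
  rw [PowerSeries.coeff_subst' (PowerSeries.HasSubst.of_constantCoeff_zero' hS)]
  refine finsum_eq_sum_of_support_subset _ fun k hk => ?_
  by_contra hk'
  refine hk ?_
  dsimp only
  rw [coeff_pow_eq_zero_of_lt hS (by simpa using hk'), smul_zero]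

/-- Where a family of power series vanishes, the derivatives of the coefficients of its powers
beyond the first vanish. -/
lemma hasDerivAt_coeff_pow_succ {S : ℂ → PowerSeries ℂ} {S' : ℕ → ℂ} {x : ℂ} {N : ℕ}
    (hS : ∀ M ≤ N, HasDerivAt (fun b => PowerSeries.coeff M (S b)) (S' M) x)
    (h0 : ∀ M ≤ N, PowerSeries.coeff M (S x) = 0) (k : ℕ) :
    ∀ M ≤ N, HasDerivAt (fun b => PowerSeries.coeff M (S b ^ (k + 1)))
      (if k = 0 then S' M else 0) x ∧ PowerSeries.coeff M (S x ^ (k + 1)) = 0 := by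
  induction k with
  | zero => intro M hM; simpa using ⟨hS M hM, h0 M hM⟩
  | succ k ih =>
    intro M hM
    simp only [pow_succ _ (k + 1), PowerSeries.coeff_mul]
    have hle : ∀ p ∈ Finset.HasAntidiagonal.antidiagonal M, p.1 ≤ N ∧ p.2 ≤ N := fun p hp => by
      rw [Finset.HasAntidiagonal.mem_antidiagonal] at hp
      omega
    constructor
    · have h : HasDerivAt (fun b => ∑ p ∈ Finset.HasAntidiagonal.antidiagonal M,
          PowerSeries.coeff p.1 (S b ^ (k + 1)) * PowerSeries.coeff p.2 (S b))
          (∑ p ∈ Finset.HasAntidiagonal.antidiagonal M, (0 : ℂ)) x :=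
        -- Both factors vanish at `x`, so the product rule gives zero.
        HasDerivAt.fun_sum fun p hp => by
          have h1 := ih p.1 (hle p hp).1
          have h := h1.1.mul (hS p.2 (hle p hp).2)
          rwa [h1.2, h0 p.2 (hle p hp).2, mul_zero, zero_mul, add_zero] at h
      simpa using h
    · refine Finset.sum_eq_zero fun p hp => ?_
      rw [h0 p.2 (hle p hp).2, mul_zero]

lemma hasDerivAt_symZ {τ : ℂ} (hτ : 0 < τ.im) {N : ℕ} (hN : 1 ≤ N) {ξ : Fin 4 → ℂ}
    (hξ : ∑ A, ξ A = 0) (hH : ∀ M ∈ Finset.Icc 1 N, HeckeRegular M τ ξ) :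
    HasDerivAt (fun b : ℂ => symZ N τ (withB1 ξ b))
      (-((1 / (N : ℂ)) * ∑ d ∈ N.divisors, ∑ b ∈ Finset.range (N / d),
        (d : ℂ) * I1 (((d : ℂ) * τ + b) / ((N / d : ℕ) : ℂ)) (fun A => (d : ℂ) * ξ A))) 1 := by
  have hS : ∀ M ≤ N, HasDerivAt
      (fun b => PowerSeries.coeff M (heckeSeries τ (withB1 ξ b)))
      (-((1 / (M : ℂ)) * ∑ d ∈ M.divisors, ∑ b ∈ Finset.range (M / d),
        (d : ℂ) * I1 (((d : ℂ) * τ + b) / ((M / d : ℕ) : ℂ)) (fun A => (d : ℂ) * ξ A))) 1 := by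
    intro M hM
    simp only [heckeSeries, PowerSeries.coeff_mk]
    refine hasDerivAt_heckeT hτ hξ ?_
    -- For `M = 0` regularity is vacuous, since `0` has an empty set of divisors.
    rcases Nat.eq_zero_or_pos M with rfl | hM0
    · intro d hd
      simp at hd
    · exact hH M (Finset.mem_Icc.2 ⟨hM0, hM⟩)
  have h0 : ∀ M ≤ N, PowerSeries.coeff M (heckeSeries τ (withB1 ξ 1)) = 0 := fun M _ => by
    rw [heckeSeries, PowerSeries.coeff_mk, heckeT_withB1_one hτ M hξ]
  simp only [symZ, coeff_exp_subst (constantCoeff_heckeSeries _ _), Finset.sum_range_succ']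
  -- The constant term of the exponential contributes nothing because `N ≥ 1`.
  have hzero : ∀ b, PowerSeries.coeff 0 (PowerSeries.exp ℂ) *
      PowerSeries.coeff N (heckeSeries τ (withB1 ξ b) ^ 0) = 0 := fun b => by
    rw [pow_zero, PowerSeries.coeff_one, if_neg (by omega), mul_zero]
  simp only [hzero, add_zero]
  have h := HasDerivAt.fun_sum (u := Finset.range N) fun k _ =>
    ((hasDerivAt_coeff_pow_succ hS h0 k N le_rfl).1.const_mul
      (PowerSeries.coeff (k + 1) (PowerSeries.exp ℂ)))
  convert! h using 1
  -- Only the linear term of the exponential survives, with coefficient `1/1!`.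
  rw [Finset.sum_eq_single_of_mem 0 (Finset.mem_range.2 hN) fun k _ hk => by
    rw [if_neg hk, mul_zero]]
  simp [PowerSeries.coeff_exp]

end

end SymR8

theorem mainTheorem2 :
    (∀ (τ : ℂ) (ξ : Fin 4 → ℂ), 0 < τ.im → ∑ A, ξ A = 0 → Regular τ ξ →
      DifferentiableAt ℂ (fun b : ℂ => Z1 τ (withB1 ξ b)) 1 ∧
      I1 τ ξ = Complex.I * ModularForm.eta τ ^ 3 *
        (theta1 τ (ξ 0 + ξ 3) * theta1 τ (ξ 1 + ξ 3) * theta1 τ (ξ 2 + ξ 3)) /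
        ∏ A, theta1 τ (ξ A)) ∧
    (∀ (N : ℕ) (τ : ℂ) (ξ : Fin 4 → ℂ), 1 ≤ N → 0 < τ.im → ∑ A, ξ A = 0 →
      HeckeRegular N τ ξ → (∀ d ∈ N.divisors, Regular τ (fun A => (d : ℂ) * ξ A)) →
      (1 / (N : ℂ)) * ∑ d ∈ N.divisors, ∑ b ∈ Finset.range (N / d),
          (d : ℂ) * I1 (((d : ℂ) * τ + b) / ((N / d : ℕ) : ℂ)) (fun A => (d : ℂ) * ξ A)
        = ∑ d ∈ N.divisors, I1 τ (fun A => (d : ℂ) * ξ A)) ∧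
    (∀ (N : ℕ) (τ : ℂ) (ξ : Fin 4 → ℂ), 1 ≤ N → 0 < τ.im → ∑ A, ξ A = 0 →
      (∀ M ∈ Finset.Icc 1 N, HeckeRegular M τ ξ) →
      (∀ d ∈ N.divisors, Regular τ (fun A => (d : ℂ) * ξ A)) →
      DifferentiableAt ℂ (fun b : ℂ => symZ N τ (withB1 ξ b)) 1 ∧
      symIndex N τ ξ = (1 / (N : ℂ)) * ∑ d ∈ N.divisors, ∑ b ∈ Finset.range (N / d),
          (d : ℂ) * I1 (((d : ℂ) * τ + b) / ((N / d : ℕ) : ℂ)) (fun A => (d : ℂ) * ξ A) ∧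
      symIndex N τ ξ = ∑ d ∈ N.divisors, I1 τ (fun A => (d : ℂ) * ξ A)) := by
  refine ⟨fun τ ξ hτ hξ hreg => ?_, fun N τ ξ hN hτ hξ hH hreg => ?_,
    fun N τ ξ hN hτ hξ hH hreg => ?_⟩
  · exact ⟨(hasDerivAt_Z1_withB1_one hτ hξ hreg).differentiableAt,
      I1_eq_thetaQuotient hτ hξ hreg⟩
  · exact hecke_sum_I1 hτ (by omega) hξ hH hreg
  · have h := hasDerivAt_symZ hτ hN hξ hH
    have hI : symIndex N τ ξ = (1 / (N : ℂ)) * ∑ d ∈ N.divisors, ∑ b ∈ Finset.range (N / d),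
        (d : ℂ) * I1 (((d : ℂ) * τ + b) / ((N / d : ℕ) : ℂ)) (fun A => (d : ℂ) * ξ A) := by
      rw [symIndex, indexOp, h.deriv, neg_neg]
    exact ⟨h.differentiableAt, hI, hI.trans (hecke_sum_I1 hτ (by omega) hξ
      (hH N (Finset.mem_Icc.2 ⟨hN, le_rfl⟩)) hreg)⟩
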